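/- Let $\mathbb F_q$ be a finite field with $q$ elements, $A=\mathbb F_q[T]$, $K_\infty=\mathbb F_q((1/T))$ with $|T|=q$, let $C$ be the completion of an algebraic closure of $K_\infty$, and let $\Omega=C\setminus K_\infty$, on which $\mathrm{GL}_2(A)$ acts by $\gamma(z)=\frac{az+b}{cz+d}$ for $\gamma=\begin{pmatrix}a&b\\c&d\end{pmatrix}$. "Holomorphic" means rigid analytic. For a holomorphic function $f:\Omega\to C$ and $n\ge 0$, the hyperderivative $\mathcal D_nf:\Omega\to C$ is defined by $f(z+\varepsilon)=\sum_{n\ge 0}(\mathcal D_nf)(z)\,\varepsilon^n$ for $z\in\Omega$ and $\varepsilon\in C$ with $|\varepsilon|$ small. Let $e_{\mathcal C}(z)=\sum_{n\ge0} z^{q^n}/d_n$, with $d_n=\prod_{j=1}^{n}(T^{q^j}-T)^{q^{n-j}}$, be the Carlitz exponential, let $\overline\pi$ be a fundamental period of the Carlitz module (that is, $\overline\pi\neq0$ and $\ker e_{\mathcal C}=\overline\pi A$), and put $t(z)=1/e_{\mathcal C}(\overline\pi z)$ and $|z|_i=\inf_{x\in K_\infty}|z-x|$. Let $\mathcal O$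 be the ring of holomorphic functions $f:\Omega\to C$ such that $f(z+a)=f(z)$ for all $a\in A$, $z\in\Omega$, and such that for suitable $c_0,c_1,\ldots\in C$ one has $f(z)=\sum_{i\ge0}c_i\,t(z)^i$ for all $z\in\Omega$ with $|z|_i$ sufficiently large. For integers $w,l\ge 0$ and $m\in\mathbb Z/(q-1)\mathbb Z$, let $\widetilde M_{w,m}^{\le l}$ be the space of quasi-modular forms of weight $w$, type $m$ and depth $\le l$, i.e. of holomorphic functions $f:\Omega\to C$ for which there are $f_0,\ldots,f_l\in\mathcal O$ such that $$f(\gamma(z))=(cz+d)^w(\det\gamma)^{-m}\sum_{i=0}^{l}f_i(z)\Bigl(\frac{c}{cz+d}\Bigr)^i\qquad\text{for all } z\in\Omega,\ \gamma=\begin{pmatrix}a&b\\c&d\end{pmatrix}\in \mathrm{GL}_2(A).$$ The polynomial $P_f=\sum_{i=0}^l f_iX^i\in\mathcal O[X]$ is uniquely determined by $f$ and is called the associated polynomial of $f$ (with $P_0=0$). **Proposition.** Let $f\in\widetilde M_{w,m}^{\le l}$, with associated polynomial $P_f=\sum_{i=0}^{l}f_iX^i$. Then, for all $n\ge 0$,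 $\mathcal D_nf$ is an element of $\widetilde M_{w+2n,\,m+n}^{\le l+n}$, with associated polynomial $$P_{\mathcal D_nf}=\sum_{j=0}^{n+l}\Biggl[\sum_{r=0}^{n}\binom{n+w+r-j-1}{r}\,\mathcal D_{n-r}f_{j-r}\Biggr]X^j,$$ with the conventions that $f_i=0$ if $i<0$ or $i>l$, and that for an integer $N$ and $r\ge0$ one has $\binom{N}{r}=0$ if $0\le N<r$ and $\binom{N}{r}=(-1)^r\binom{r-N-1}{r}$ if $N<0$. -/

import Mathlib

open Polynomial

noncomputable section

namespace Drinfeld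

/-! ### The fields `K_∞` and `C` -/

/-- `K_∞ = 𝔽_q((1/T))`, the completion of `K = 𝔽_q(T)` at the place at infinity. -/
abbrev KInf (F : Type*) [Field F] : Type _ := @RatFunc.CompletionAtInfty F _ (Classical.decEq _)

lemma kInf_v_coe (F : Type*) [Field F] (x : RatFunc F) :
    Valued.v (algebraMap (RatFunc F) (KInf F) x) =
      @RatFunc.inftyValuation F _ (Classical.decEq _) x := by
  let _ := Classical.decEq (RatFunc F)
  let _ := RatFunc.inftyValued F
  exact Valued.extensionValuation_apply_coe x

variable (F : Type*) [Field F] [Fintype F]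

lemma one_lt_card_nnreal : (1 : NNReal) < (Fintype.card F : NNReal) := by
  exact_mod_cast Fintype.one_lt_card

/-- The absolute value of `K_∞` is normalized by `|T| = q`. -/
instance kInfRankOne :
    Valuation.RankOne (Valued.v : Valuation (KInf F) (WithZero (Multiplicative ℤ))) where
  hom' := (WithZeroMulInt.toNNReal (one_lt_card_nnreal F).ne_zero).comp
    MonoidWithZeroHom.ValueGroup₀.embedding
  strictMono' := (WithZeroMulInt.toNNReal_strictMono (one_lt_card_nnreal F)).comp
    MonoidWithZeroHom.ValueGroup₀.embedding_strictMono
  exists_val_nontrivial := by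
    let _ := Classical.decEq (RatFunc F)
    refine ⟨algebraMap (RatFunc F) (KInf F) RatFunc.X, ?_⟩
    rw [kInf_v_coe]
    simp

instance kInfNormedField : NormedField (KInf F) := Valued.toNormedField (KInf F) _

instance kInfUltra : IsUltrametricDist (KInf F) :=
  inferInstanceAs (@IsUltrametricDist (KInf F) (Valued.toNormedField (KInf F) _).toDist)

instance kInfComplete : CompleteSpace (KInf F) := by
  let _ := Classical.decEq (RatFunc F)
  let _ := RatFunc.inftyValued F
  exact inferInstanceAs (CompleteSpace (UniformSpace.Completion (RatFunc F)))

lemma norm_kInf (x : KInf F) :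
    ‖x‖ = WithZeroMulInt.toNNReal (one_lt_card_nnreal F).ne_zero (Valued.v x) := by
  change ((WithZeroMulInt.toNNReal (one_lt_card_nnreal F).ne_zero
    (MonoidWithZeroHom.ValueGroup₀.embedding (Valued.v.restrict x)) : NNReal) : ℝ) = _
  rw [Valuation.embedding_restrict]

lemma norm_algebraMap_ratFunc (x : RatFunc F) (hx : x ≠ 0) :
    ‖algebraMap (RatFunc F) (KInf F) x‖ = (Fintype.card F : ℝ) ^ x.intDegree := by
  let _ := Classical.decEq (RatFunc F)
  rw [norm_kInf, kInf_v_coe, RatFunc.inftyValuation_apply, RatFunc.inftyValuation_of_nonzero F hx,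
    WithZeroMulInt.toNNReal_neg_apply _ (by simp)]
  simp
  rfl

instance kInfNontrivially : NontriviallyNormedField (KInf F) where
  non_trivial := by
    refine ⟨algebraMap (RatFunc F) (KInf F) RatFunc.X, ?_⟩
    rw [norm_algebraMap_ratFunc F _ RatFunc.X_ne_zero, RatFunc.intDegree_X, zpow_one]
    exact_mod_cast Fintype.one_lt_card

/-- The algebraic closure of `K_∞`. -/
abbrev KInfAlg : Type _ := AlgebraicClosure (KInf F)

/-- The absolute value on the algebraic closure of `K_∞` is the unique extension of that
of `K_∞`. -/
instance kInfAlgNontrivially : NontriviallyNormedField (KInfAlg F) :=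
  spectralNorm.nontriviallyNormedField (KInf F) (KInfAlg F)

instance kInfAlgNormedAlgebra : NormedAlgebra (KInf F) (KInfAlg F) :=
  spectralNorm.normedAlgebra (KInf F) (KInfAlg F)

instance kInfAlgUltra : IsUltrametricDist (KInfAlg F) :=
  IsUltrametricDist.isUltrametricDist_of_forall_norm_add_le_max_norm
    (isNonarchimedean_spectralNorm (K := KInf F) (L := KInfAlg F))

/-- The field `C`, the completion of an algebraic closure of `K_∞`. -/
def CInf : Type _ := UniformSpace.Completion (KInfAlg F)

instance : NormedField (CInf F) := inferInstanceAs (NormedField (UniformSpace.Completion _))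
instance : CompleteSpace (CInf F) := inferInstanceAs (CompleteSpace (UniformSpace.Completion _))
instance : NormedAlgebra (KInf F) (CInf F) :=
  inferInstanceAs (NormedAlgebra (KInf F) (UniformSpace.Completion (KInfAlg F)))
instance : NormedAlgebra (KInfAlg F) (CInf F) :=
  inferInstanceAs (NormedAlgebra (KInfAlg F) (UniformSpace.Completion (KInfAlg F)))
instance : IsScalarTower (KInf F) (KInfAlg F) (CInf F) :=
  IsScalarTower.of_algebraMap_eq (congrFun rfl)
instance : IsUltrametricDist (CInf F) := IsUltrametricDist.of_normedAlgebra (KInf F)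
instance : NontriviallyNormedField (CInf F) where
  non_trivial := by
    obtain ⟨x, hx⟩ := NontriviallyNormedField.non_trivial (α := KInf F)
    exact ⟨algebraMap _ _ x, by rwa [norm_algebraMap']⟩

lemma denseRange_algebraMap_cInf : DenseRange (algebraMap (KInfAlg F) (CInf F)) :=
  UniformSpace.Completion.denseRange_coe

/-- The embedding of `A = 𝔽_q[T]` in `C`. -/
def ofA : F[X] →+* CInf F :=
  (algebraMap (KInf F) (CInf F)).comp
    ((algebraMap (RatFunc F) (KInf F)).comp (algebraMap F[X] (RatFunc F)))

/-! ### The Drinfeld upper half plane -/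

/-- `Ω = C ∖ K_∞`. -/
def Omega : Set (CInf F) := (Set.range (algebraMap (KInf F) (CInf F)))ᶜ

variable {F}

lemma ofA_injective : Function.Injective (ofA F) :=
  (algebraMap (KInf F) (CInf F)).injective.comp
    ((algebraMap (RatFunc F) (KInf F)).injective.comp (RatFunc.algebraMap_injective F))

/-- The translate `z + a` of `z ∈ Ω` by `a ∈ A`. -/
def translate (a : F[X]) (z : Omega F) : Omega F :=
  ⟨z + ofA F a, by
    rintro ⟨x, hx⟩
    exact z.2 ⟨x - algebraMap (RatFunc F) (KInf F) (algebraMap F[X] (RatFunc F) a), by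
      rw [map_sub, hx]; simp [ofA]⟩⟩

/-- `cz + d`, for `γ = (a b; c d)`. -/
def den (γ : GL (Fin 2) F[X]) (z : CInf F) : CInf F := ofA F (γ 1 0) * z + ofA F (γ 1 1)

/-- The determinant of `γ`, as an element of `C`. -/
def detC (γ : GL (Fin 2) F[X]) : CInf F := ofA F (γ : Matrix (Fin 2) (Fin 2) F[X]).det

lemma detC_ne_zero (γ : GL (Fin 2) F[X]) : detC γ ≠ 0 := by
  have h : (γ : Matrix (Fin 2) (Fin 2) F[X]).det ≠ 0 :=
    ((Matrix.isUnit_iff_isUnit_det _).1 γ.isUnit).ne_zero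
  simpa [detC] using (map_ne_zero_iff _ ofA_injective).2 h

lemma detC_eq (γ : GL (Fin 2) F[X]) :
    detC γ = ofA F (γ 0 0) * ofA F (γ 1 1) - ofA F (γ 0 1) * ofA F (γ 1 0) := by
  simp [detC, Matrix.det_fin_two]

lemma ofA_eq (a : F[X]) : ofA F a = algebraMap (KInf F) (CInf F)
    (algebraMap (RatFunc F) (KInf F) (algebraMap F[X] (RatFunc F) a)) := rfl

lemma den_ne_zero (γ : GL (Fin 2) F[X]) (z : Omega F) : den γ z ≠ 0 := by
  intro h
  have hd := detC_ne_zero γ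
  rw [detC_eq] at hd
  unfold den at h
  by_cases hc : ofA F (γ 1 0) = 0
  · rw [hc, zero_mul, zero_add] at h
    simp [hc, h] at hd
  · refine z.2 ⟨-(algebraMap (RatFunc F) (KInf F) (algebraMap F[X] (RatFunc F) (γ 1 1))) /
      algebraMap (RatFunc F) (KInf F) (algebraMap F[X] (RatFunc F) (γ 1 0)), ?_⟩
    rw [map_div₀, map_neg, ← ofA_eq, ← ofA_eq, div_eq_iff hc]
    linear_combination -h

/-- The action `γ(z) = (az + b) / (cz + d)` of `GL₂(A)` on `Ω`. -/
def moebius (γ : GL (Fin 2) F[X]) (z : Omega F) : Omega F :=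
  ⟨(ofA F (γ 0 0) * z + ofA F (γ 0 1)) / den γ z, by
    rintro ⟨x, hx⟩
    rw [eq_div_iff (den_ne_zero γ z)] at hx
    have hd := detC_ne_zero γ
    rw [detC_eq] at hd
    unfold den at hx
    set y := algebraMap (KInf F) (CInf F) x with hy
    by_cases h0 : ofA F (γ 0 0) - y * ofA F (γ 1 0) = 0
    · refine hd ?_
      linear_combination (ofA F (γ 1 1)) * h0 + ofA F (γ 1 0) * (hx + (z : CInf F) * h0)
    · refine z.2 ⟨(x * algebraMap (RatFunc F) (KInf F) (algebraMap F[X] (RatFunc F) (γ 1 1)) -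
        algebraMap (RatFunc F) (KInf F) (algebraMap F[X] (RatFunc F) (γ 0 1))) /
        (algebraMap (RatFunc F) (KInf F) (algebraMap F[X] (RatFunc F) (γ 0 0)) -
        x * algebraMap (RatFunc F) (KInf F) (algebraMap F[X] (RatFunc F) (γ 1 0))), ?_⟩
      rw [map_div₀, map_sub, map_sub, map_mul, map_mul, ← ofA_eq, ← ofA_eq, ← ofA_eq, ← ofA_eq,
        ← hy, div_eq_iff h0]
      linear_combination hx⟩

/-! ### Holomorphic functions and hyperderivatives -/

/-- The imaginary part `|z|_i = inf {|z - x| : x ∈ K_∞}`. -/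
def imagPart (z : CInf F) : ℝ := Metric.infDist z (Set.range (algebraMap (KInf F) (CInf F)))

variable (F) in
/-- The affinoid subdomains `{z : |z| ≤ q ^ n, |z|_i ≥ q ^ (-n)}`, which form an admissible
covering of `Ω`. -/
def affinoid (n : ℕ) : Set (CInf F) :=
  {z | ‖z‖ ≤ (Fintype.card F : ℝ) ^ n ∧ ((Fintype.card F : ℝ) ^ n)⁻¹ ≤ imagPart z}

/-- `f : Ω → C` is holomorphic in the rigid analytic sense: on each affinoid of the covering,
it is a uniform limit of rational functions without poles there. -/
def IsHolomorphic (f : Omega F → CInf F) : Prop :=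
  ∀ n : ℕ, ∀ ε : ℝ, 0 < ε → ∃ P Q : (CInf F)[X], (∀ z ∈ affinoid F n, Q.eval z ≠ 0) ∧
    ∀ z : Omega F, (z : CInf F) ∈ affinoid F n →
      ‖f z - P.eval (z : CInf F) / Q.eval (z : CInf F)‖ < ε

/-- `f (z + ε) = ∑ aₙ εⁿ` for all `ε ∈ C` with `|ε|` small. -/
def HasTaylorExpansionAt (f : Omega F → CInf F) (z : Omega F) (a : ℕ → CInf F) : Prop :=
  ∃ ρ : ℝ, 0 < ρ ∧ ∀ ε : CInf F, ‖ε‖ < ρ →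
    ∃ h : (z : CInf F) + ε ∈ Omega F, HasSum (fun n => a n * ε ^ n) (f ⟨z + ε, h⟩)

open Classical in
/-- The hyperderivative `𝒟ₙ f`: its value at `z` is the coefficient of `εⁿ` in the Taylor
expansion of `f` at `z`. Such an expansion is unique when it exists, and it exists for all
holomorphic functions; the value `0` elsewhere is a convention. -/
def hyperDeriv (n : ℕ) (f : Omega F → CInf F) (z : Omega F) : CInf F :=
  if h : ∃ a, HasTaylorExpansionAt f z a then h.choose n else 0

/-! ### The parameter at infinity -/

variable (F) in
/-- `dᵢ = [i] [i-1]^q ⋯ [1]^(q^(i-1))` with `[j] = T^(q^j) - T`. -/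
def carlitzD (i : ℕ) : F[X] :=
  ∏ j ∈ Finset.Icc 1 i, (X ^ Fintype.card F ^ j - X) ^ Fintype.card F ^ (i - j)

/-- The Carlitz exponential `e_C(z) = ∑ z^(q^n) / dₙ`. -/
def carlitzExp (z : CInf F) : CInf F :=
  ∑' n : ℕ, z ^ Fintype.card F ^ n / ofA F (carlitzD F n)

/-- `ϖ` is a fundamental period of the Carlitz module: the kernel of the Carlitz exponential is the
free `A`-module of rank one generated by `ϖ`. -/
def IsFundamentalPeriod (ϖ : CInf F) : Prop :=
  ϖ ≠ 0 ∧ {z : CInf F | carlitzExp z = 0} = Set.range fun a : F[X] => ϖ * ofA F a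

/-- The parameter at infinity `t(z) = 1 / e_C(ϖ z)`. -/
def tParam (ϖ : CInf F) (z : Omega F) : CInf F := 1 / carlitzExp (ϖ * (z : CInf F))

/-- `f(z) = ∑ cᵢ t(z)ⁱ` for all `z ∈ Ω` with `|z|_i` sufficiently large. -/
def IsHolomorphicAtInfty (ϖ : CInf F) (f : Omega F → CInf F) : Prop :=
  ∃ c : ℕ → CInf F, ∃ M : ℝ, ∀ z : Omega F, M ≤ imagPart (z : CInf F) →
    HasSum (fun i => c i * tParam ϖ z ^ i) (f z)

/-- The ring `𝒪` of holomorphic functions on `Ω` that are `A`-periodic and holomorphic at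
infinity. -/
def ringO (ϖ : CInf F) : Set (Omega F → CInf F) :=
  {f | IsHolomorphic f ∧ (∀ (a : F[X]) (z : Omega F), f (translate a z) = f z) ∧
    IsHolomorphicAtInfty ϖ f}

/-! ### Quasi-modular forms -/

/-- `P ∈ 𝒪[X]` is a polynomial associated to `f` in weight `w` and type `m`:
`f(γ(z)) = (cz+d)^w (det γ)^(-m) ∑ fᵢ(z) (c/(cz+d))ⁱ`, where `P = ∑ fᵢ Xⁱ`.
Since `det γ ∈ 𝔽_q^*`, the power `(det γ)^(-m)` depends only on `m` modulo `q - 1`. -/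
def IsAssociated (ϖ : CInf F) (w : ℕ) (m : ZMod (Fintype.card F - 1))
    (f : Omega F → CInf F) (P : (Omega F → CInf F)[X]) : Prop :=
  (∀ i, P.coeff i ∈ ringO ϖ) ∧
  ∀ (γ : GL (Fin 2) F[X]) (z : Omega F),
    f (moebius γ z) = den γ z ^ w * detC γ ^ (-(m.val : ℤ)) *
      ∑ i ∈ Finset.range (P.natDegree + 1), P.coeff i z * (ofA F (γ 1 0) / den γ z) ^ i

/-- The space of quasi-modular forms of weight `w`, type `m` and depth `≤ l`. -/
def quasiModular (ϖ : CInf F) (w : ℕ) (m : ZMod (Fintype.card F - 1)) (l : ℕ) :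
    Set (Omega F → CInf F) :=
  {f | IsHolomorphic f ∧ ∃ P, IsAssociated ϖ w m f P ∧ P.natDegree ≤ l}

open Classical in
/-- The associated polynomial `P_f` of a quasi-modular form `f`. It is uniquely determined by `f`
(and is `0` for `f = 0`); the value `0` for functions that are not quasi-modular is a
convention. -/
def assocPoly (ϖ : CInf F) (f : Omega F → CInf F) : (Omega F → CInf F)[X] :=
  if h : ∃ P, ∃ w m, IsAssociated ϖ w m f P then h.choose else 0

/-- The coefficient of `Xⁱ` in `P`, for an integer `i`; it is `0` if `i < 0`. -/
def coeffInt (P : (Omega F → CInf F)[X]) (i : ℤ) : Omega F → CInf F :=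
  if 0 ≤ i then P.coeff i.toNat else 0

end Drinfeld

end

/-!
# Hyperderivatives of Drinfeld quasi-modular forms

Let `D = cz + d` and `δ = det γ`. The substitution `ε = D² η / (δ - c D η)` gives
`γ(z + ε) = γ(z) + η` and `c(z + ε) + d = D (1 - c D η / δ)⁻¹`. Hence the functional equation of `f`
at `z + ε` reads

  `f(γ(z) + η) = δ⁻ᵐ ∑ᵢ cⁱ Dʷ⁻ⁱ (1 - x η)ⁱ⁻ʷ fᵢ(z + ε)`,  with `x = c D / δ`.

Expanding `fᵢ(z + ε) = ∑ₛ (𝒟ₛ fᵢ)(z) εˢ` and the powers of `1 - x η` by the binomial series, the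
coefficient of `ηⁿ` is the asserted formula (`SumsTo.moebiusSubst`,
`IsAssociated.hyperDeriv_moebius`, `eval_specialize_hyperDerivPoly`). All rearrangements of series
are harmless since in a complete ultrametric field every family tending to zero is summable.

It remains to see that hyperderivatives preserve the ring `𝒪` and that associated polynomials are
unique.

* Holomorphy. The field `C` is algebraically closed, so a rational function without poles on an
  affinoid expands on discs of a fixed radius around the points of this affinoid. Cauchy's
  inequality `SumsTo.norm_coeff_mul_pow_le` shows that the Taylor coefficients are continuous for
  uniform convergence; since those of rational functions are again rational, hyperderivatives of
  holomorphic functions exist and are holomorphic (`IsHolomorphic.hyperDeriv`). The same inequality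
  gives the uniqueness of Taylor expansions.
* Behaviour at infinity. By additivity of the Carlitz exponential,
  `t(z + ε) = t(z) / (1 + t(z) e_C(ϖ ε))`, so that the coefficients of the expansion of
  `∑ cᵢ t(z + ε)ⁱ` in `ε` are power series in `t(z)` (`IsHolomorphicAtInfty.hyperDeriv`).
* Uniqueness. For fixed `z`, the functional equation is an identity of Laurent polynomials in
  `cz + d`, which takes infinitely many values for `c = 1` and for `c = T`
  (`IsAssociated.unique`).
-/

noncomputable section

/-! ### Completions of algebraically closed fields -/

/-- A complete ultrametric field with a dense algebraically closed subfield is algebraically closed,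
in any characteristic: by continuity of roots, a root of a monic irreducible polynomial in its
splitting field is a limit of elements of the complete, hence closed, base field. -/
theorem isAlgClosed_of_denseRange {K L : Type*} [Field K] [NontriviallyNormedField L]
    [CompleteSpace L] [IsUltrametricDist L] [Algebra K L]
    (hi : DenseRange (algebraMap K L)) [IsAlgClosed K] : IsAlgClosed L := by
  apply IsAlgClosed.of_exists_root
  intro f fmon firr
  have fnatdeg0 : f.natDegree ≠ 0 := (Irreducible.natDegree_pos firr).ne'
  let E := f.SplittingField
  let : NormedField E := spectralNorm.normedField L E
  let : NormedAlgebra L E := spectralNorm.normedAlgebra L E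
  let a := rootOfSplits (SplittingField.splits f)
      (by simpa using degree_ne_of_natDegree_ne fnatdeg0)
  have fa0 : f.aeval a = 0 := by
    rw [← eval_map_algebraMap]
    exact eval_rootOfSplits (Polynomial.SplittingField.splits f)
      (by simpa using degree_ne_of_natDegree_ne fnatdeg0)
  have hclosed : IsClosed (Set.range (algebraMap L E)) :=
    ((algebraMap_isometry L E).isClosedEmbedding).isClosed_range
  have ha : a ∈ Set.range (algebraMap L E) := by
    rw [← hclosed.closure_eq, Metric.mem_closure_iff]
    intro δ δpos
    have hε : (δ / (max ‖a‖ 1)) ^ f.natDegree / (f.natDegree + 1) > 0 := by positivity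
    obtain ⟨g, gmon, gdeg, gcoeff⟩ :=
      exists_monic_and_natDegree_eq_and_norm_map_algebraMap_coeff_sub_lt hi fmon hε
    obtain ⟨b, hb, hab⟩ := exists_aroots_norm_sub_lt_of_norm_coeff_sub_lt
      hε fa0 fmon (gmon.map _) (gdeg ▸ (g.natDegree_map _)) gcoeff
      (by simpa [Polynomial.map_map] using (IsAlgClosed.splits g).map ((algebraMap L E).comp _))
    rw [Polynomial.aroots_def, Splits.roots_map ((IsAlgClosed.splits g).map _),
      Multiset.mem_map] at hb
    obtain ⟨c, _, rfl⟩ := hb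
    refine ⟨_, ⟨c, rfl⟩, ?_⟩
    rw [dist_eq_norm]
    refine hab.trans_eq ?_
    rw [mul_div_cancel₀ _ (by positivity), ← Real.rpow_natCast, ← Real.rpow_mul (by positivity),
      mul_inv_cancel₀ (by exact_mod_cast fnatdeg0), Real.rpow_one,
      div_mul_cancel₀ _ (by positivity)]
  obtain ⟨x, hx⟩ := ha
  refine ⟨x, ?_⟩
  have : algebraMap L E (f.eval x) = 0 := by
    rw [← fa0, ← hx, aeval_algebraMap_apply_eq_algebraMap_eval]
  simpa using this

/-! ### Evaluation of power series over an ultrametric field -/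

lemma HasSum.of_eq {ι α : Type*} [AddCommMonoid α] [TopologicalSpace α] {f g : ι → α} {a b : α}
    (h : HasSum f a) (hfg : ∀ i, g i = f i) (hab : b = a) : HasSum g b := by
  rwa [hab, funext hfg]

section SumsTo

variable {K : Type*} [NontriviallyNormedField K]

open PowerSeries

/-- The power series `p` converges at `x`, with sum `v`. -/
def SumsTo (p : K⟦X⟧) (x v : K) : Prop := HasSum (fun n => coeff n p * x ^ n) v

namespace SumsTo

variable {p r : K⟦X⟧} {x v w : K}

lemma unique (h : SumsTo p x v) (h' : SumsTo p x w) : v = w := HasSum.unique h h'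

lemma sub (hp : SumsTo p x v) (hr : SumsTo r x w) : SumsTo (p - r) x (v - w) := by
  simpa [SumsTo, sub_mul] using HasSum.sub hp hr

lemma sum {ι : Type*} {s : Finset ι} {p : ι → K⟦X⟧} {x : K} {v : ι → K}
    (h : ∀ i ∈ s, SumsTo (p i) x (v i)) : SumsTo (∑ i ∈ s, p i) x (∑ i ∈ s, v i) := by
  simpa [SumsTo, Finset.sum_mul] using hasSum_sum h

lemma polynomial (P : K[X]) (x : K) : SumsTo (P : K⟦X⟧) x (P.eval x) := by
  rw [SumsTo, eval_eq_sum_range]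
  simp only [Polynomial.coeff_coe]
  refine hasSum_sum_of_ne_finset_zero fun n hn => ?_
  rw [coeff_eq_zero_of_natDegree_lt (by simpa using hn), zero_mul]

lemma one (x : K) : SumsTo 1 x 1 := by
  simpa using polynomial (1 : K[X]) x

lemma const (c x : K) : SumsTo (PowerSeries.C c) x c := by
  simpa using polynomial (Polynomial.C c) x

lemma X (x : K) : SumsTo (PowerSeries.X : K⟦X⟧) x x := by
  have := polynomial (Polynomial.X : K[X]) x
  rwa [Polynomial.coe_X, eval_X] at this

lemma rescale (c : K) (h : SumsTo p (c * x) v) : SumsTo (PowerSeries.rescale c p) x v := by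
  rw [SumsTo] at h ⊢
  simpa [coeff_rescale, mul_pow, mul_assoc, mul_left_comm] using h

end SumsTo

end SumsTo

section Ultrametric

variable {K : Type*} [NontriviallyNormedField K] [IsUltrametricDist K]

open Filter Topology PowerSeries

lemma HasSum.norm_le_of_ultrametric {ι : Type*} {f : ι → K} {v : K} {M : ℝ} (h : HasSum f v)
    (hM : 0 ≤ M) (hf : ∀ i, ‖f i‖ ≤ M) : ‖v‖ ≤ M :=
  le_of_tendsto' h.norm fun _ =>
    IsUltrametricDist.norm_sum_le_of_forall_le_of_nonneg hM fun i _ => hf i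

lemma norm_intCast_le_one (n : ℤ) : ‖(n : K)‖ ≤ 1 := by
  obtain ⟨n, rfl | rfl⟩ := n.eq_nat_or_neg
  · simpa using IsUltrametricDist.norm_natCast_le_one K n
  · simpa using IsUltrametricDist.norm_natCast_le_one K n

lemma norm_add_le_of_ultrametric {x y : K} {M : ℝ} (hx : ‖x‖ ≤ M) (hy : ‖y‖ ≤ M) :
    ‖x + y‖ ≤ M :=
  (IsUltrametricDist.norm_add_le_max x y).trans (max_le hx hy)

lemma norm_sub_le_of_ultrametric {x y : K} {M : ℝ} (hx : ‖x‖ ≤ M) (hy : ‖y‖ ≤ M) :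
    ‖x - y‖ ≤ M := by
  rw [sub_eq_add_neg]
  exact norm_add_le_of_ultrametric hx (by rwa [norm_neg])

instance nonarchimedeanRing_of_isUltrametricDist : NonarchimedeanRing K where
  is_nonarchimedean := NonarchimedeanAddGroup.is_nonarchimedean

/-- Summing a family over `ℕ × ℕ` along the antidiagonals. -/
lemma HasSum.antidiagonal {F : ℕ × ℕ → K} {V : K} (h : HasSum F V) :
    HasSum (fun n => ∑ x ∈ Finset.HasAntidiagonal.antidiagonal n, F x) V := by
  have h1 := (Finset.HasAntidiagonal.sigmaAntidiagonalEquivProd (A := ℕ)).hasSum_iff.2 h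
  refine h1.sigma fun n => ?_
  have h2 := Finset.hasSum (Finset.HasAntidiagonal.antidiagonal n) F
  exact h2

/-- Interchange of the order of summation in a summable double family. -/
lemma HasSum.swap_of_summable {ι κ : Type*} {F : ι × κ → K} (hF : Summable F) {v : ι → K}
    {w : κ → K} {V : K} (hv : ∀ i, HasSum (fun k => F (i, k)) (v i))
    (hw : ∀ k, HasSum (fun i => F (i, k)) (w k)) (hV : HasSum v V) : HasSum w V := by
  have h1 := hF.hasSum.prod_fiberwise hv
  rw [hV.unique h1]
  exact ((Equiv.prodComm κ ι).hasSum_iff.2 hF.hasSum).prod_fiberwise hw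

namespace SumsTo

variable {p r : K⟦X⟧} {x v w : K}

lemma mul (hp : SumsTo p x v) (hr : SumsTo r x w) : SumsTo (p * r) x (v * w) := by
  have h := (HasSum.mul_of_nonarchimedean hp hr).antidiagonal
  rw [SumsTo]
  convert h using 2 with n
  rw [PowerSeries.coeff_mul, Finset.sum_mul]
  refine Finset.sum_congr rfl fun z hz => ?_
  rw [← Finset.HasAntidiagonal.mem_antidiagonal.1 hz, pow_add]
  ring

lemma pow (hp : SumsTo p x v) (n : ℕ) : SumsTo (p ^ n) x (v ^ n) := by
  induction n with
  | zero => simpa using one x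
  | succ n ih => simpa [pow_succ] using ih.mul hp

/-- Convergence of `p` at `x` does not imply that of `p⁻¹`, hence the hypothesis `hs`. -/
lemma inv_of_summable (h0 : constantCoeff p ≠ 0) (hp : SumsTo p x v)
    (hs : Summable fun n => coeff n p⁻¹ * x ^ n) : SumsTo p⁻¹ x v⁻¹ := by
  obtain ⟨w, hw⟩ := hs
  have h1 : SumsTo (p * p⁻¹) x (v * w) := hp.mul hw
  rw [PowerSeries.mul_inv_cancel p h0] at h1
  rw [inv_eq_of_mul_eq_one_right (h1.unique (one x))]
  exact hw

end SumsTo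

/-! ### Cauchy's inequality -/

section Cauchy

variable [IsAlgClosed K]

/-- **Cauchy's inequality**. The coefficient is read off by averaging over the `N`-th roots of unity
for `N = ℓ ^ s - 1`, which has norm one in characteristic `ℓ`. -/
lemma SumsTo.norm_coeff_mul_pow_le (ℓ : ℕ) [Fact ℓ.Prime] [CharP K ℓ] {p : K⟦X⟧} {y : K} {M : ℝ}
    (hM : 0 ≤ M) (h : ∀ x, ‖x‖ = ‖y‖ → ∃ v, SumsTo p x v ∧ ‖v‖ ≤ M) (k : ℕ) :
    ‖coeff k p‖ * ‖y‖ ^ k ≤ M := by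
  by_contra! hlt
  set A := ‖coeff k p‖ * ‖y‖ ^ k with hA
  set B := max M (A / 2) with hB
  have hBA : B < A := max_lt hlt (by linarith)
  have hB0 : 0 < B := lt_max_of_lt_right (by linarith)
  obtain ⟨v₀, hv₀, -⟩ := h y rfl
  have ht : Tendsto (fun n => ‖coeff n p * y ^ n‖) atTop (𝓝 0) := by
    simpa using (HasSum.summable hv₀).tendsto_atTop_zero.norm
  obtain ⟨N₀, hN₀⟩ := eventually_atTop.1 (ht.eventually_le_const hB0)
  have hℓ := (Fact.out : ℓ.Prime)
  -- `N = ℓ ^ s - 1` is so large that the terms of index at least `N` are small and `k < N`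
  set s := N₀ + k + 1 with hs
  have hsN : s < ℓ ^ s := Nat.lt_pow_self hℓ.one_lt
  obtain ⟨N, hN⟩ : ∃ N, ℓ ^ s = N + 1 := ⟨ℓ ^ s - 1, by omega⟩
  have hNK : (N : K) = -1 := by
    have : ((ℓ ^ s : ℕ) : K) = 0 := by simp [hs]
    rw [hN] at this
    push_cast at this
    exact eq_neg_of_add_eq_zero_left this
  have : NeZero (N : K) := ⟨by simp [hNK]⟩
  obtain ⟨ζ, hζ⟩ := HasEnoughRootsOfUnity.prim (M := K) (n := N)
  have hN0 : N ≠ 0 := by omega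
  have hζ1 : ‖ζ‖ = 1 := by
    have : ‖ζ‖ ^ N = 1 := by rw [← norm_pow, hζ.pow_eq_one, norm_one]
    exact (pow_eq_one_iff_of_nonneg (norm_nonneg _) hN0).1 this
  have hx : ∀ i : ℕ, ‖y * ζ ^ i‖ = ‖y‖ := fun i => by simp [hζ1]
  choose v hv hvM using fun i : ℕ => h (y * ζ ^ i) (hx i)
  -- averaging `p` over the points `y ζ ^ i`, twisted by a character, only retains the terms whose
  -- index is congruent to `k` modulo `N`
  have hsum : HasSum (fun n => (∑ i ∈ Finset.range N, (ζ ^ (N - k + n)) ^ i) *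
      (coeff n p * y ^ n)) (∑ i ∈ Finset.range N, ζ ^ (i * (N - k)) * v i) := by
    have := hasSum_sum (s := Finset.range N)
      fun i _ => HasSum.mul_left (ζ ^ (i * (N - k))) (hv i)
    have heq : ∀ n, ∑ i ∈ Finset.range N, ζ ^ (i * (N - k)) * (coeff n p * (y * ζ ^ i) ^ n) =
        (∑ i ∈ Finset.range N, (ζ ^ (N - k + n)) ^ i) * (coeff n p * y ^ n) := fun n => by
      rw [Finset.sum_mul]
      refine Finset.sum_congr rfl fun i _ => ?_
      rw [mul_pow, ← pow_mul, ← pow_mul, mul_comm (N - k + n) i, mul_add, pow_add]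
      ring
    simpa only [heq] using this
  have hgeom : ∀ m : ℕ, ∑ i ∈ Finset.range N, (ζ ^ m) ^ i = if N ∣ m then (N : K) else 0 := by
    intro m
    split_ifs with hm
    · rw [(hζ.pow_eq_one_iff_dvd m).2 hm]; simp
    · rw [geom_sum_eq (fun h => hm ((hζ.pow_eq_one_iff_dvd m).1 h)), ← pow_mul, mul_comm, pow_mul,
        hζ.pow_eq_one]
      simp
  simp only [hgeom] at hsum
  have hrest := hsum.sub (hasSum_ite_eq k ((N : K) * (coeff k p * y ^ k)))
  have h1 : ‖(∑ i ∈ Finset.range N, ζ ^ (i * (N - k)) * v i) - N * (coeff k p * y ^ k)‖ ≤ B := by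
    refine hrest.norm_le_of_ultrametric hB0.le fun n => ?_
    by_cases hnk : n = k
    · subst hnk
      rw [if_pos ⟨1, by omega⟩, if_pos rfl]
      simpa using hB0.le
    · rw [if_neg hnk, sub_zero]
      split_ifs with hd
      · obtain ⟨c, hc⟩ := hd
        have : N ≤ n := by
          rcases c with _ | _ | c
          · omega
          · omega
          · have : N * (c + 1 + 1) = N * c + 2 * N := by ring
            omega
        rw [hNK]
        simpa using hN₀ n (by omega)
      · simpa using hB0.le
  have h2 : ‖∑ i ∈ Finset.range N, ζ ^ (i * (N - k)) * v i‖ ≤ B :=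
    IsUltrametricDist.norm_sum_le_of_forall_le_of_nonneg hB0.le fun i _ => by
      rw [norm_mul, norm_pow, hζ1, one_pow, one_mul]
      exact (hvM i).trans (le_max_left _ _)
  have h3 := norm_sub_le_of_ultrametric h2 h1
  rw [sub_sub_cancel, hNK] at h3
  simp only [norm_mul, norm_neg, norm_one, one_mul, norm_pow] at h3
  exact absurd h3 (not_le.2 hBA)

/-- Power series with close values on a circle have close coefficients. -/
lemma SumsTo.norm_coeff_sub_coeff_mul_pow_le (ℓ : ℕ) [Fact ℓ.Prime] [CharP K ℓ] {p r : K⟦X⟧} {y : K}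
    {f g : K → K} {M : ℝ} (hM : 0 ≤ M) (hp : ∀ x, ‖x‖ = ‖y‖ → SumsTo p x (f x))
    (hr : ∀ x, ‖x‖ = ‖y‖ → SumsTo r x (g x)) (h : ∀ x, ‖x‖ = ‖y‖ → ‖f x - g x‖ ≤ M) (k : ℕ) :
    ‖coeff k p - coeff k r‖ * ‖y‖ ^ k ≤ M := by
  rw [← map_sub]
  exact SumsTo.norm_coeff_mul_pow_le ℓ hM (fun x hx => ⟨_, (hp x hx).sub (hr x hx), h x hx⟩) k

end Cauchy

/-! ### Binomial series, rational functions and uniform limits -/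

lemma summable_iff_tendsto_norm [CompleteSpace K] {ι : Type*} {f : ι → K} :
    Summable f ↔ Tendsto (fun i => ‖f i‖) cofinite (𝓝 0) := by
  rw [NonarchimedeanAddGroup.summable_iff_tendsto_cofinite_zero, tendsto_zero_iff_norm_tendsto_zero]

lemma Summable.of_norm_le_norm [CompleteSpace K] {ι : Type*} {f g : ι → K} (hg : Summable g)
    (h : ∀ i, ‖f i‖ ≤ ‖g i‖) : Summable f :=
  summable_iff_tendsto_norm.2 (squeeze_zero (fun _ => norm_nonneg _) h
    (summable_iff_tendsto_norm.1 hg))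

/-- The binomial series represents `y ↦ (1 + y) ^ N` on the open unit disc. -/
lemma sumsTo_binomialSeries [CompleteSpace K] (N : ℤ) {y : K} (hy : ‖y‖ < 1) :
    SumsTo (binomialSeries K N) y ((1 + y) ^ N) := by
  have hnat : ∀ d : ℕ, SumsTo (binomialSeries K (d : ℤ)) y ((1 + y) ^ d) := fun d => by
    rw [binomialSeries_nat (R := ℤ) (A := K) d]
    have := SumsTo.polynomial ((1 + Polynomial.X) ^ d : K[X]) y
    rw [Polynomial.coe_pow, Polynomial.coe_add, Polynomial.coe_one, Polynomial.coe_X] at this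
    simpa only [eval_pow, eval_add, eval_one, eval_X] using this
  obtain ⟨d, rfl | rfl⟩ := N.eq_nat_or_neg
  · simpa using hnat d
  · have h1 : binomialSeries K (-(d : ℤ)) * binomialSeries K (d : ℤ) = 1 := by
      rw [← binomialSeries_add, neg_add_cancel, binomialSeries_zero]
    have h0 : constantCoeff (binomialSeries K (d : ℤ)) ≠ 0 := by simp
    have h2 := (PowerSeries.eq_inv_iff_mul_eq_one h0).2 h1
    rw [zpow_neg, zpow_natCast, h2]
    refine SumsTo.inv_of_summable h0 (hnat d) ?_
    rw [← h2]
    refine (summable_geometric_of_norm_lt_one hy).of_norm_le_norm fun n => ?_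
    rw [norm_mul, binomialSeries_coeff, zsmul_eq_mul, mul_one]
    exact mul_le_of_le_one_left (norm_nonneg _) (norm_intCast_le_one _)

/-- The inverse of a polynomial without zeros on a closed disc around `0` is represented there by a
power series. -/
lemma sumsTo_inv_polynomial [IsAlgClosed K] {Q : K[X]} {R : ℝ} (hQ : ∀ x, ‖x‖ ≤ R → Q.eval x ≠ 0)
    {x : K} (hx : ‖x‖ ≤ R) : SumsTo (Q : K⟦X⟧)⁻¹ x (Q.eval x)⁻¹ := by
  have h0 : constantCoeff (Q : K⟦X⟧) ≠ 0 := by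
    have := hQ 0 (by simpa using (norm_nonneg x).trans hx)
    rwa [← Polynomial.coeff_zero_eq_eval_zero, ← Polynomial.coeff_coe,
      PowerSeries.coeff_zero_eq_constantCoeff_apply] at this
  refine SumsTo.inv_of_summable h0 (SumsTo.polynomial Q x) ?_
  suffices h : ∃ v, SumsTo (Q : K⟦X⟧)⁻¹ x v from h.choose_spec.summable
  have hlin : ∀ a : K, R < ‖a‖ → ∃ v,
      SumsTo ((Polynomial.X - Polynomial.C a : K[X]) : K⟦X⟧)⁻¹ x v := by
    intro a ha
    have ha0 : a ≠ 0 := norm_pos_iff.1 (((norm_nonneg x).trans hx).trans_lt ha)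
    have h1 : (PowerSeries.mk fun n => -a⁻¹ ^ (n + 1)) =
        ((Polynomial.X - Polynomial.C a : K[X]) : K⟦X⟧)⁻¹ := by
      rw [PowerSeries.eq_inv_iff_mul_eq_one (by simpa using ha0)]
      ext n
      rcases n with _ | n
      · simp [mul_sub, ha0]
      · simp [mul_sub, PowerSeries.coeff_one, PowerSeries.coeff_succ_mul_X]
        field_simp
        ring
    rw [← h1]
    have h2 : Summable fun n => (a⁻¹ * x) ^ n := by
      refine summable_geometric_of_norm_lt_one ?_
      rw [norm_mul, norm_inv, inv_mul_lt_one₀ (norm_pos_iff.2 ha0)]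
      exact hx.trans_lt ha
    obtain ⟨v, hv⟩ := h2.mul_left (-a⁻¹)
    refine ⟨v, ?_⟩
    rw [SumsTo]
    simpa [pow_succ, mul_pow, mul_assoc, mul_left_comm] using hv
  have hprod : ∀ s : Multiset K, (∀ a ∈ s, R < ‖a‖) → ∃ v,
      SumsTo (((s.map fun a => Polynomial.X - Polynomial.C a).prod : K[X]) : K⟦X⟧)⁻¹ x v := by
    intro s
    induction s using Multiset.induction with
    | empty => exact fun _ => ⟨1, by simpa using SumsTo.one x⟩
    | cons a s ih =>
      intro hs
      obtain ⟨v, hv⟩ := ih fun b hb => hs b (Multiset.mem_cons_of_mem hb)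
      obtain ⟨w, hw⟩ := hlin a (hs a (Multiset.mem_cons_self a s))
      refine ⟨v * w, ?_⟩
      rw [Multiset.map_cons, Multiset.prod_cons, Polynomial.coe_mul, PowerSeries.mul_inv_rev]
      exact hv.mul hw
  obtain ⟨v, hv⟩ := hprod Q.roots fun a ha => by
    by_contra! h
    exact hQ a h (Polynomial.isRoot_of_mem_roots ha)
  rw [(IsAlgClosed.splits Q).eq_prod_roots, Polynomial.coe_mul, PowerSeries.mul_inv_rev,
    Polynomial.coe_C, PowerSeries.C_inv]
  exact ⟨_, hv.mul (SumsTo.const _ x)⟩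

/-- A uniform limit of power series on a closed disc is represented there by a power series: by
Cauchy's inequality the coefficients converge, uniformly after scaling by the powers of the
radius. -/
lemma exists_sumsTo_of_uniform_limit [CompleteSpace K] [IsAlgClosed K] (ℓ : ℕ) [Fact ℓ.Prime]
    [CharP K ℓ] {y : K} (hy : y ≠ 0) {g : K → K}
    (h : ∀ ε > 0, ∃ (p : K⟦X⟧) (f : K → K), ∀ x, ‖x‖ ≤ ‖y‖ →
      SumsTo p x (f x) ∧ ‖g x - f x‖ ≤ ε) : ∃ p, ∀ x, ‖x‖ ≤ ‖y‖ → SumsTo p x (g x) := by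
  have hy' : 0 < ‖y‖ := norm_pos_iff.2 hy
  choose p f hpf using fun j : ℕ => h (1 / ((j : ℝ) + 1)) (by positivity)
  have hanti : ∀ {i j : ℕ}, i ≤ j → 1 / ((j : ℝ) + 1) ≤ 1 / ((i : ℝ) + 1) := fun hij =>
    one_div_le_one_div_of_le (by positivity) (by gcongr)
  have hij : ∀ i j k, i ≤ j → ‖coeff k (p j) - coeff k (p i)‖ * ‖y‖ ^ k ≤ 1 / ((i : ℝ) + 1) := by
    intro i j k hle
    refine SumsTo.norm_coeff_sub_coeff_mul_pow_le ℓ (by positivity)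
      (fun x hx => (hpf j x hx.le).1) (fun x hx => (hpf i x hx.le).1) (fun x hx => ?_) k
    rw [← sub_sub_sub_cancel_left _ _ (g x)]
    exact norm_sub_le_of_ultrametric (hpf i x hx.le).2 ((hpf j x hx.le).2.trans (hanti hle))
  have hlim : ∀ k, ∃ a, Tendsto (fun j => coeff k (p j)) atTop (𝓝 a) := by
    intro k
    refine cauchySeq_tendsto_of_complete (Metric.cauchySeq_iff'.2 fun ε hε => ?_)
    obtain ⟨i, hi⟩ := exists_nat_one_div_lt (show 0 < ε * ‖y‖ ^ k by positivity)
    refine ⟨i, fun j hle => ?_⟩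
    rw [dist_eq_norm]
    exact lt_of_mul_lt_mul_right ((hij i j k hle).trans_lt hi) (by positivity)
  choose a ha using hlim
  have hai : ∀ i k, ‖a k - coeff k (p i)‖ * ‖y‖ ^ k ≤ 1 / ((i : ℝ) + 1) := by
    intro i k
    refine le_of_tendsto ((((ha k).sub_const _).norm).mul_const _)
      (eventually_atTop.2 ⟨i, fun j hle => hij i j k hle⟩)
  have hterm : ∀ i k x, ‖x‖ ≤ ‖y‖ → ‖a k * x ^ k - coeff k (p i) * x ^ k‖ ≤ 1 / ((i : ℝ) + 1) := by
    intro i k x hx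
    rw [← sub_mul, norm_mul, norm_pow]
    exact le_trans (by gcongr) (hai i k)
  refine ⟨PowerSeries.mk a, fun x hx => ?_⟩
  have hsm : Summable fun k => a k * x ^ k := by
    rw [NonarchimedeanAddGroup.summable_iff_tendsto_cofinite_zero, Nat.cofinite_eq_atTop,
      Metric.tendsto_atTop]
    intro ε hε
    obtain ⟨i, hi⟩ := exists_nat_one_div_lt hε
    obtain ⟨N, hN⟩ := Metric.tendsto_atTop.1
      (HasSum.summable (hpf i x hx).1).tendsto_atTop_zero ε hε
    refine ⟨N, fun n hn => ?_⟩
    have h1 := hN n hn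
    rw [dist_zero_right] at h1 ⊢
    rw [← sub_add_cancel (a n * x ^ n) (coeff n (p i) * x ^ n)]
    exact (IsUltrametricDist.norm_add_le_max _ _).trans_lt
      (max_lt ((hterm i n x hx).trans_lt hi) h1)
  obtain ⟨v, hv⟩ := hsm
  have hvg : v = g x := by
    refine eq_of_forall_dist_le fun ε hε => ?_
    obtain ⟨i, hi⟩ := exists_nat_one_div_lt hε
    have h1 : ‖v - f i x‖ ≤ 1 / ((i : ℝ) + 1) :=
      (hv.sub (hpf i x hx).1).norm_le_of_ultrametric (by positivity) fun k => hterm i k x hx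
    rw [dist_eq_norm, ← sub_sub_sub_cancel_right _ _ (f i x)]
    exact (norm_sub_le_of_ultrametric h1 (hpf i x hx).2).trans hi.le
  rw [SumsTo, ← hvg]
  simpa using hv

end Ultrametric

namespace Drinfeld

/-! ### Taylor coefficients of rational functions -/

section RegularOn

variable {K : Type*} [Field K]

/-- The ring of functions that agree on `S` with a rational function without poles in `S`. -/
def regularOn (S : Set K) : Subring (K → K) where
  carrier := {g | ∃ P Q : K[X], (∀ z ∈ S, Q.eval z ≠ 0) ∧ ∀ z ∈ S, g z = P.eval z / Q.eval z}
  zero_mem' := ⟨0, 1, by simp, by simp⟩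
  one_mem' := ⟨1, 1, by simp, by simp⟩
  add_mem' := by
    rintro g h ⟨P, Q, hQ, hg⟩ ⟨P', Q', hQ', hh⟩
    refine ⟨P * Q' + Q * P', Q * Q', fun z hz => by simp [hQ z hz, hQ' z hz], fun z hz => ?_⟩
    simp [hg z hz, hh z hz, div_add_div _ _ (hQ z hz) (hQ' z hz)]
  mul_mem' := by
    rintro g h ⟨P, Q, hQ, hg⟩ ⟨P', Q', hQ', hh⟩
    refine ⟨P * P', Q * Q', fun z hz => by simp [hQ z hz, hQ' z hz], fun z hz => ?_⟩
    simp [hg z hz, hh z hz, div_mul_div_comm]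
  neg_mem' := by
    rintro g ⟨P, Q, hQ, hg⟩
    exact ⟨-P, Q, hQ, fun z hz => by simp [hg z hz, neg_div]⟩

lemma polynomial_mem_regularOn (S : Set K) (P : K[X]) : (fun z => P.eval z) ∈ regularOn S :=
  ⟨P, 1, by simp, by simp⟩

lemma inv_polynomial_mem_regularOn {S : Set K} {Q : K[X]} (hQ : ∀ z ∈ S, Q.eval z ≠ 0) :
    (fun z => (Q.eval z)⁻¹) ∈ regularOn S :=
  ⟨1, Q, hQ, by simp⟩

/-- The expansion at `z` of the rational function `P / Q`. -/
def ratTaylor (P Q : K[X]) (z : K) : PowerSeries K :=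
  (taylor z P : PowerSeries K) * (taylor z Q : PowerSeries K)⁻¹

/-- The Taylor coefficients of a rational function depend rationally on the base point, without
introducing new poles. -/
lemma coeff_ratTaylor_mem_regularOn {S : Set K} (P : K[X]) {Q : K[X]}
    (hQ : ∀ z ∈ S, Q.eval z ≠ 0) (k : ℕ) :
    (fun z => PowerSeries.coeff k (ratTaylor P Q z)) ∈ regularOn S := by
  have hpol : ∀ (R : K[X]) (j : ℕ),
      (fun z => PowerSeries.coeff j (taylor z R : PowerSeries K)) ∈ regularOn S := fun R j => by
    simpa only [Polynomial.coeff_coe, taylor_coeff] using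
      polynomial_mem_regularOn S (hasseDeriv j R)
  have hinv : ∀ j : ℕ,
      (fun z => PowerSeries.coeff j (taylor z Q : PowerSeries K)⁻¹) ∈ regularOn S := by
    intro j
    have hc : (fun z => (PowerSeries.constantCoeff (taylor z Q : PowerSeries K))⁻¹) ∈
        regularOn S := by
      simpa only [← PowerSeries.coeff_zero_eq_constantCoeff_apply, Polynomial.coeff_coe,
        taylor_coeff_zero] using inv_polynomial_mem_regularOn hQ
    induction j using Nat.strong_induction_on with
    | _ j ih =>
      have hrec : (fun z => PowerSeries.coeff j (taylor z Q : PowerSeries K)⁻¹) = fun z => _ :=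
        funext fun z => PowerSeries.coeff_inv j (taylor z Q : PowerSeries K)
      rw [hrec]
      split_ifs with hj
      · exact hc
      · have hs : (∑ x ∈ Finset.HasAntidiagonal.antidiagonal j, fun z => if x.2 < j then
            PowerSeries.coeff x.1 (taylor z Q : PowerSeries K) *
              PowerSeries.coeff x.2 (taylor z Q : PowerSeries K)⁻¹ else 0) ∈ regularOn S := by
          refine sum_mem fun x _ => ?_
          split_ifs with hx
          · exact mul_mem (hpol Q x.1) (ih x.2 hx)
          · exact zero_mem _
        have := mul_mem (neg_mem hc) hs
        convert this using 1
        funext z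
        simp
  have : (∑ x ∈ Finset.HasAntidiagonal.antidiagonal k, fun z =>
      PowerSeries.coeff x.1 (taylor z P : PowerSeries K) *
        PowerSeries.coeff x.2 (taylor z Q : PowerSeries K)⁻¹) ∈ regularOn S :=
    sum_mem fun x _ => mul_mem (hpol P x.1) (hinv x.2)
  convert this using 1
  funext z
  simp [ratTaylor, PowerSeries.coeff_mul]

end RegularOn

variable {F : Type*} [Field F] [Fintype F]

/-! ### Discs in the affinoids -/

instance : IsAlgClosed (CInf F) := isAlgClosed_of_denseRange (denseRange_algebraMap_cInf F)

lemma exists_prime_charP_cInf (F : Type*) [Field F] [Fintype F] :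
    ∃ ℓ : ℕ, ℓ.Prime ∧ CharP (CInf F) ℓ := by
  obtain ⟨ℓ, hℓ⟩ := CharP.exists F
  exact ⟨ℓ, (CharP.char_is_prime F ℓ),
    charP_of_injective_ringHom (f := (ofA F).comp (C : F →+* F[X]))
      (ofA_injective.comp C_injective) ℓ⟩

lemma one_lt_card_real (F : Type*) [Field F] [Fintype F] : (1 : ℝ) < Fintype.card F := by
  exact_mod_cast Fintype.one_lt_card

lemma norm_ofA {a : F[X]} (ha : a ≠ 0) : ‖ofA F a‖ = (Fintype.card F : ℝ) ^ a.natDegree := by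
  rw [ofA_eq, norm_algebraMap', norm_algebraMap_ratFunc F _ (RatFunc.algebraMap_ne_zero ha),
    RatFunc.intDegree_polynomial, zpow_natCast]

variable (F) in
/-- The element `T ^ (-(N + 1))`, whose absolute value is the radius of discs contained in the
`N`-th affinoid around each of its points. -/
def discRadius (N : ℕ) : CInf F := (ofA F X)⁻¹ ^ (N + 1)

lemma norm_discRadius (N : ℕ) : ‖discRadius F N‖ = ((Fintype.card F : ℝ) ^ (N + 1))⁻¹ := by
  simp [discRadius, norm_ofA X_ne_zero]

lemma discRadius_ne_zero (N : ℕ) : discRadius F N ≠ 0 := by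
  have := ofA_injective.ne (X_ne_zero (R := F))
  simpa [discRadius] using this

lemma norm_discRadius_lt (N : ℕ) : ‖discRadius F N‖ < ((Fintype.card F : ℝ) ^ N)⁻¹ := by
  have := one_lt_card_real F
  rw [norm_discRadius]
  gcongr
  omega

lemma imagPart_pos (z : Omega F) : 0 < imagPart (z : CInf F) := by
  have hc : IsClosed (Set.range (algebraMap (KInf F) (CInf F))) :=
    (algebraMap_isometry (KInf F) (CInf F)).isClosedEmbedding.isClosed_range
  exact (hc.notMem_iff_infDist_pos (Set.range_nonempty _)).1 z.2

lemma mem_omega_of_imagPart_pos {z : CInf F} (h : 0 < imagPart z) : z ∈ Omega F := by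
  intro hz
  rw [imagPart, Metric.infDist_zero_of_mem hz] at h
  exact h.false

lemma le_imagPart_add {z ε : CInf F} {δ : ℝ} (hz : δ ≤ imagPart z) (hε : ‖ε‖ < δ) :
    δ ≤ imagPart (z + ε) := by
  refine (Metric.le_infDist (Set.range_nonempty _)).2 fun x hx => ?_
  have h1 : δ ≤ dist z x := (Metric.le_infDist (Set.range_nonempty _)).1 hz hx
  rw [dist_eq_norm] at h1 ⊢
  rw [show z + ε - x = z - x + ε by ring,
    IsUltrametricDist.norm_add_eq_max_of_norm_ne_norm (hε.trans_le h1).ne']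
  exact h1.trans (le_max_left _ _)

lemma add_mem_affinoid {N : ℕ} {z ε : CInf F} (hz : z ∈ affinoid F N)
    (hε : ‖ε‖ ≤ ‖discRadius F N‖) : z + ε ∈ affinoid F N := by
  have h1 := hε.trans_lt (norm_discRadius_lt N)
  have hq := one_lt_card_real F
  refine ⟨norm_add_le_of_ultrametric hz.1 (h1.le.trans ?_), le_imagPart_add hz.2 h1⟩
  exact (inv_le_one_of_one_le₀ (one_le_pow₀ hq.le)).trans (one_le_pow₀ hq.le)

lemma affinoid_subset_omega (N : ℕ) : affinoid F N ⊆ Omega F := fun z hz => by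
  have hq := one_lt_card_real F
  exact mem_omega_of_imagPart_pos (lt_of_lt_of_le (by positivity) hz.2)

lemma exists_mem_affinoid (z : Omega F) : ∃ N, (z : CInf F) ∈ affinoid F N := by
  have hq := one_lt_card_real F
  obtain ⟨N, hN⟩ := pow_unbounded_of_one_lt (max ‖(z : CInf F)‖ (imagPart (z : CInf F))⁻¹) hq
  refine ⟨N, ((le_max_left _ _).trans hN.le), ?_⟩
  exact inv_le_of_inv_le₀ (imagPart_pos z) ((le_max_right _ _).trans hN.le)

/-! ### Taylor expansions of holomorphic functions -/

/-- The extension of a function on `Ω` by zero to `C`. -/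
def extendZero (f : Omega F → CInf F) : CInf F → CInf F := Function.extend Subtype.val f 0

lemma extendZero_of_mem (f : Omega F → CInf F) {z : CInf F} (hz : z ∈ Omega F) :
    extendZero f z = f ⟨z, hz⟩ :=
  Subtype.val_injective.extend_apply f 0 ⟨z, hz⟩

@[simp] lemma extendZero_coe (f : Omega F → CInf F) (z : Omega F) :
    extendZero f (z : CInf F) = f z := extendZero_of_mem f z.2

/-- Taylor expansions are unique, by Cauchy's inequality. -/
lemma HasTaylorExpansionAt.unique {f : Omega F → CInf F} {z : Omega F} {a b : ℕ → CInf F}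
    (ha : HasTaylorExpansionAt f z a) (hb : HasTaylorExpansionAt f z b) : a = b := by
  obtain ⟨ℓ, hℓ, _⟩ := exists_prime_charP_cInf F
  have : Fact ℓ.Prime := ⟨hℓ⟩
  obtain ⟨ρ, hρ, ha⟩ := ha
  obtain ⟨σ, hσ, hb⟩ := hb
  obtain ⟨y, hy0, hy⟩ := NormedField.exists_norm_lt (CInf F) (lt_min hρ hσ)
  funext k
  have h := SumsTo.norm_coeff_sub_coeff_mul_pow_le ℓ (p := PowerSeries.mk a)
    (r := PowerSeries.mk b) (y := y) (M := 0) (f := fun x => extendZero f (z + x))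
    (g := fun x => extendZero f (z + x)) le_rfl (fun x hx => ?_) (fun x hx => ?_) (by simp) k
  · simp only [PowerSeries.coeff_mk] at h
    have h1 : 0 < ‖y‖ ^ k := pow_pos hy0 k
    have h2 : ‖a k - b k‖ ≤ 0 := by
      by_contra! h3
      exact absurd h (not_le.2 (mul_pos h3 h1))
    exact sub_eq_zero.1 (norm_le_zero_iff.1 h2)
  · obtain ⟨hm, hs⟩ := ha x (hx ▸ hy.trans_le (min_le_left _ _))
    simpa [SumsTo, extendZero_of_mem f hm] using hs
  · obtain ⟨hm, hs⟩ := hb x (hx ▸ hy.trans_le (min_le_right _ _))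
    simpa [SumsTo, extendZero_of_mem f hm] using hs

lemma HasTaylorExpansionAt.hyperDeriv_eq {f : Omega F → CInf F} {z : Omega F} {a : ℕ → CInf F}
    (ha : HasTaylorExpansionAt f z a) (n : ℕ) : hyperDeriv n f z = a n := by
  have h : ∃ a, HasTaylorExpansionAt f z a := ⟨a, ha⟩
  rw [hyperDeriv, dif_pos h, h.choose_spec.unique ha]

lemma ratTaylor_sumsTo {N : ℕ} (P : (CInf F)[X]) {Q : (CInf F)[X]}
    (hQ : ∀ z ∈ affinoid F N, Q.eval z ≠ 0) {z ε : CInf F} (hz : z ∈ affinoid F N)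
    (hε : ‖ε‖ ≤ ‖discRadius F N‖) :
    SumsTo (ratTaylor P Q z) ε (P.eval (z + ε) / Q.eval (z + ε)) := by
  have h1 := SumsTo.polynomial (taylor z P) ε
  have h2 := sumsTo_inv_polynomial (Q := taylor z Q) (R := ‖discRadius F N‖) (fun x hx => by
    rw [taylor_eval, add_comm]
    exact hQ _ (add_mem_affinoid hz hx)) hε
  have := h1.mul h2
  rwa [taylor_eval, taylor_eval, add_comm ε z, ← div_eq_mul_inv] at this

/-- A holomorphic function is represented by a power series on a disc around `z`, whose radius
depends only on an affinoid containing `z`. -/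
lemma IsHolomorphic.exists_sumsTo {f : Omega F → CInf F} (hf : IsHolomorphic f) {N : ℕ}
    {z : CInf F} (hz : z ∈ affinoid F N) : ∃ p : PowerSeries (CInf F), ∀ ε,
      ‖ε‖ ≤ ‖discRadius F N‖ → SumsTo p ε (extendZero f (z + ε)) := by
  obtain ⟨ℓ, hℓ, _⟩ := exists_prime_charP_cInf F
  have : Fact ℓ.Prime := ⟨hℓ⟩
  refine exists_sumsTo_of_uniform_limit ℓ (discRadius_ne_zero N) fun η hη => ?_
  obtain ⟨P, Q, hQ, hPQ⟩ := hf N η hη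
  refine ⟨ratTaylor P Q z, fun x => P.eval (z + x) / Q.eval (z + x), fun x hx =>
    ⟨ratTaylor_sumsTo P hQ hz hx, ?_⟩⟩
  have hm := add_mem_affinoid hz hx
  rw [extendZero_of_mem f (affinoid_subset_omega N hm)]
  exact (hPQ ⟨_, affinoid_subset_omega N hm⟩ hm).le

lemma hasTaylorExpansionAt_of_sumsTo {f : Omega F → CInf F} {z : Omega F} {ρ : ℝ} (hρ : 0 < ρ)
    {p : PowerSeries (CInf F)}
    (h : ∀ ε, ‖ε‖ < ρ → SumsTo p ε (extendZero f (z + ε))) :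
    HasTaylorExpansionAt f z fun n => PowerSeries.coeff n p := by
  obtain ⟨N, hN⟩ := exists_mem_affinoid z
  refine ⟨min ρ ‖discRadius F N‖, lt_min hρ (norm_pos_iff.2 (discRadius_ne_zero N)),
    fun ε hε => ?_⟩
  have hm := affinoid_subset_omega N
    (add_mem_affinoid hN (hε.le.trans (min_le_right _ _)))
  refine ⟨hm, ?_⟩
  rw [← extendZero_of_mem f hm]
  exact h ε (hε.trans_le (min_le_left _ _))

lemma IsHolomorphic.sumsTo_hyperDeriv {f : Omega F → CInf F} (hf : IsHolomorphic f) {N : ℕ}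
    {z : Omega F} (hz : (z : CInf F) ∈ affinoid F N) {ε : CInf F} (hε : ‖ε‖ ≤ ‖discRadius F N‖) :
    SumsTo (PowerSeries.mk fun n => hyperDeriv n f z) ε (extendZero f (z + ε)) := by
  obtain ⟨p, hp⟩ := hf.exists_sumsTo hz
  have h1 := hasTaylorExpansionAt_of_sumsTo (norm_pos_iff.2 (discRadius_ne_zero N))
    fun ε hε => hp ε hε.le
  have h2 : (PowerSeries.mk fun n => hyperDeriv n f z) = p := by
    ext n
    rw [PowerSeries.coeff_mk, h1.hyperDeriv_eq]
  rw [h2]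
  exact hp ε hε

lemma IsHolomorphic.hasTaylorExpansionAt {f : Omega F → CInf F} (hf : IsHolomorphic f)
    (z : Omega F) : HasTaylorExpansionAt f z fun n => hyperDeriv n f z := by
  obtain ⟨N, hN⟩ := exists_mem_affinoid z
  simpa using hasTaylorExpansionAt_of_sumsTo (norm_pos_iff.2 (discRadius_ne_zero N))
    fun ε hε => hf.sumsTo_hyperDeriv hN hε.le

/-- Hyperderivatives of holomorphic functions are holomorphic: by Cauchy's inequality, the
hyperderivatives of the approximating rational functions approximate that of `f`. -/
lemma IsHolomorphic.hyperDeriv {f : Omega F → CInf F} (hf : IsHolomorphic f) (k : ℕ) :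
    IsHolomorphic (hyperDeriv k f) := by
  obtain ⟨ℓ, hℓ, _⟩ := exists_prime_charP_cInf F
  have : Fact ℓ.Prime := ⟨hℓ⟩
  intro N η hη
  have hd : 0 < ‖discRadius F N‖ := norm_pos_iff.2 (discRadius_ne_zero N)
  have hη' : 0 < η / 2 * ‖discRadius F N‖ ^ k := by positivity
  obtain ⟨P, Q, hQ, hPQ⟩ := hf N _ hη'
  obtain ⟨P', Q', hQ', h'⟩ := coeff_ratTaylor_mem_regularOn P hQ k
  refine ⟨P', Q', hQ', fun z hz => ?_⟩
  rw [← h' z hz]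
  have h := SumsTo.norm_coeff_sub_coeff_mul_pow_le ℓ hη'.le
    (fun x hx => hf.sumsTo_hyperDeriv hz hx.le) (fun x hx => ratTaylor_sumsTo P hQ hz hx.le)
    (fun x hx => ?_) k
  · rw [PowerSeries.coeff_mk] at h
    exact (le_of_mul_le_mul_right h (by positivity)).trans_lt (by linarith)
  · have hm := add_mem_affinoid hz hx.le
    rw [extendZero_of_mem f (affinoid_subset_omega N hm)]
    exact (hPQ ⟨_, affinoid_subset_omega N hm⟩ hm).le

lemma IsHolomorphic.add {f g : Omega F → CInf F} (hf : IsHolomorphic f) (hg : IsHolomorphic g) :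
    IsHolomorphic (f + g) := by
  intro N η hη
  obtain ⟨P, Q, hQ, hPQ⟩ := hf N _ hη
  obtain ⟨P', Q', hQ', hPQ'⟩ := hg N _ hη
  refine ⟨P * Q' + Q * P', Q * Q', fun z hz => by simp [hQ z hz, hQ' z hz], fun z hz => ?_⟩
  have := (IsUltrametricDist.norm_add_le_max _ _).trans_lt (max_lt (hPQ z hz) (hPQ' z hz))
  simpa [← div_add_div _ _ (hQ z hz) (hQ' z hz), add_sub_add_comm] using this

lemma IsHolomorphic.neg {f : Omega F → CInf F} (hf : IsHolomorphic f) : IsHolomorphic (-f) := by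
  intro N η hη
  obtain ⟨P, Q, hQ, hPQ⟩ := hf N _ hη
  refine ⟨-P, Q, hQ, fun z hz => ?_⟩
  have := hPQ z hz
  rw [← norm_neg] at this
  simpa [neg_div, sub_eq_add_neg, add_comm] using this

lemma isHolomorphic_zero : IsHolomorphic (0 : Omega F → CInf F) :=
  fun N η hη => ⟨0, 1, by simp, by simpa using fun _ _ _ => hη⟩

lemma hyperDeriv_zero_fun (n : ℕ) : hyperDeriv n (0 : Omega F → CInf F) = 0 := by
  funext z
  obtain ⟨N, hN⟩ := exists_mem_affinoid z
  have h : HasTaylorExpansionAt (0 : Omega F → CInf F) z 0 :=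
    ⟨‖discRadius F N‖, norm_pos_iff.2 (discRadius_ne_zero N), fun ε hε =>
      ⟨affinoid_subset_omega N (add_mem_affinoid hN hε.le), by simp⟩⟩
  exact h.hyperDeriv_eq n

/-! ### Powers of a power series without constant term -/

lemma norm_coeff_pow_le {K : Type*} [NormedField K] [IsUltrametricDist K] {p : PowerSeries K}
    {B : ℝ} (hB : 0 ≤ B)
    (hp : ∀ m, ‖PowerSeries.coeff m p‖ ≤ B ^ m) (k m : ℕ) :
    ‖PowerSeries.coeff m (p ^ k)‖ ≤ B ^ m := by
  induction k generalizing m with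
  | zero =>
    rw [pow_zero, PowerSeries.coeff_one]
    split_ifs with h
    · simp [h]
    · simpa using pow_nonneg hB m
  | succ k ih =>
    rw [pow_succ, PowerSeries.coeff_mul]
    refine IsUltrametricDist.norm_sum_le_of_forall_le_of_nonneg (pow_nonneg hB m) fun x hx => ?_
    rw [norm_mul, ← Finset.HasAntidiagonal.mem_antidiagonal.1 hx, pow_add]
    exact mul_le_mul (ih _) (hp _) (norm_nonneg _) (pow_nonneg hB _)

lemma coeff_pow_eq_zero_of_lt {K : Type*} [Field K] {p : PowerSeries K}
    (hp : PowerSeries.constantCoeff p = 0)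
    {k m : ℕ} (h : m < k) : PowerSeries.coeff m (p ^ k) = 0 :=
  PowerSeries.X_pow_dvd_iff.1 (pow_dvd_pow_of_dvd (PowerSeries.X_dvd_iff.2 hp) k) m h

/-! ### The Carlitz exponential -/

lemma carlitzD_ne_zero (i : ℕ) : carlitzD F i ≠ 0 := by
  refine Finset.prod_ne_zero_iff.2 fun j hj => pow_ne_zero _ ?_
  have hj' : j ≠ 0 := by have := (Finset.mem_Icc.1 hj).1; omega
  exact FiniteField.X_pow_card_pow_sub_X_ne_zero F hj' Fintype.one_lt_card

lemma natDegree_carlitzD (i : ℕ) : (carlitzD F i).natDegree = i * Fintype.card F ^ i := by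
  have h := carlitzD_ne_zero (F := F) i
  rw [carlitzD] at h ⊢
  rw [natDegree_prod _ _ (Finset.prod_ne_zero_iff.1 h)]
  have : ∀ j ∈ Finset.Icc 1 i, ((X ^ Fintype.card F ^ j - X : F[X]) ^
      Fintype.card F ^ (i - j)).natDegree = Fintype.card F ^ i := fun j hj => by
    obtain ⟨h1, h2⟩ := Finset.mem_Icc.1 hj
    rw [natDegree_pow, FiniteField.X_pow_card_pow_sub_X_natDegree_eq F (by omega)
      Fintype.one_lt_card, ← pow_add, Nat.sub_add_cancel h2]
  rw [Finset.sum_congr rfl this]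
  simp

lemma summable_carlitzExp (z : CInf F) :
    Summable fun n : ℕ => z ^ Fintype.card F ^ n / ofA F (carlitzD F n) := by
  have hq := one_lt_card_real F
  rw [NonarchimedeanAddGroup.summable_iff_tendsto_cofinite_zero, Nat.cofinite_eq_atTop,
    tendsto_zero_iff_norm_tendsto_zero]
  have hnorm : ∀ n : ℕ, ‖z ^ Fintype.card F ^ n / ofA F (carlitzD F n)‖ =
      (‖z‖ / (Fintype.card F : ℝ) ^ n) ^ Fintype.card F ^ n := fun n => by
    rw [norm_div, norm_pow, norm_ofA (carlitzD_ne_zero n), natDegree_carlitzD, div_pow, ← pow_mul]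
  have h1 : Filter.Tendsto (fun n : ℕ => ‖z‖ / (Fintype.card F : ℝ) ^ n) Filter.atTop (nhds 0) :=
    (tendsto_pow_atTop_atTop_of_one_lt hq).const_div_atTop _
  refine squeeze_zero' (Filter.Eventually.of_forall fun _ => norm_nonneg _) ?_ h1
  filter_upwards [h1.eventually_le_const one_pos] with n hn
  rw [hnorm]
  exact pow_le_of_le_one (by positivity) hn (pow_ne_zero _ Fintype.card_ne_zero)

lemma hasSum_carlitzExp (z : CInf F) :
    HasSum (fun n : ℕ => z ^ Fintype.card F ^ n / ofA F (carlitzD F n)) (carlitzExp z) :=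
  (summable_carlitzExp z).hasSum

lemma carlitzExp_add (x y : CInf F) : carlitzExp (x + y) = carlitzExp x + carlitzExp y := by
  obtain ⟨ℓ, hℓ⟩ := CharP.exists F
  obtain ⟨r, hpr, hr⟩ := FiniteField.card F ℓ
  have : Fact ℓ.Prime := ⟨hpr⟩
  have : CharP (CInf F) ℓ := charP_of_injective_ringHom (f := (ofA F).comp (C : F →+* F[X]))
      (ofA_injective.comp C_injective) ℓ
  refine (hasSum_carlitzExp (x + y)).unique ?_
  convert (hasSum_carlitzExp x).add (hasSum_carlitzExp y) using 2 with n
  rw [← add_div, hr, ← pow_mul, add_pow_char_pow]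

variable (F) in
/-- The Carlitz exponential as a power series. -/
def carlitzSeries : PowerSeries (CInf F) :=
  PowerSeries.mk (Function.extend (fun n : ℕ => Fintype.card F ^ n)
    (fun n => (ofA F (carlitzD F n))⁻¹) 0)

lemma card_pow_injective : Function.Injective fun n : ℕ => Fintype.card F ^ n :=
  Nat.pow_right_injective Fintype.one_lt_card

lemma sumsTo_carlitzSeries (z : CInf F) : SumsTo (carlitzSeries F) z (carlitzExp z) := by
  refine ((card_pow_injective (F := F)).hasSum_iff fun m hm => ?_).1 ?_
  · rw [carlitzSeries, PowerSeries.coeff_mk, Function.extend_apply' _ _ _ hm]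
    simp
  · convert hasSum_carlitzExp z using 2 with n
    rw [Function.comp_apply, carlitzSeries, PowerSeries.coeff_mk,
      card_pow_injective.extend_apply, div_eq_inv_mul]

lemma norm_coeff_carlitzSeries_le (m : ℕ) : ‖PowerSeries.coeff m (carlitzSeries F)‖ ≤ 1 := by
  rw [carlitzSeries, PowerSeries.coeff_mk]
  by_cases h : ∃ n, Fintype.card F ^ n = m
  · obtain ⟨n, rfl⟩ := h
    rw [card_pow_injective.extend_apply, norm_inv, norm_ofA (carlitzD_ne_zero n)]
    exact inv_le_one_of_one_le₀ (one_le_pow₀ (one_lt_card_real F).le)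
  · rw [Function.extend_apply' _ _ _ h]
    simp

lemma constantCoeff_carlitzSeries : PowerSeries.constantCoeff (carlitzSeries F) = 0 := by
  rw [← PowerSeries.coeff_zero_eq_constantCoeff_apply, carlitzSeries, PowerSeries.coeff_mk,
    Function.extend_apply' _ _ _ (by simp)]
  rfl

/-- The expansion at `ε = 0` of `e_C(ϖ ε)`. -/
def periodSeries (ϖ : CInf F) : PowerSeries (CInf F) := PowerSeries.rescale ϖ (carlitzSeries F)

lemma sumsTo_periodSeries (ϖ ε : CInf F) : SumsTo (periodSeries ϖ) ε (carlitzExp (ϖ * ε)) :=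
  (sumsTo_carlitzSeries _).rescale ϖ

lemma norm_coeff_periodSeries_le (ϖ : CInf F) (m : ℕ) :
    ‖PowerSeries.coeff m (periodSeries ϖ)‖ ≤ ‖ϖ‖ ^ m := by
  rw [periodSeries, PowerSeries.coeff_rescale, norm_mul, norm_pow]
  exact mul_le_of_le_one_right (by positivity) (norm_coeff_carlitzSeries_le m)

lemma constantCoeff_periodSeries (ϖ : CInf F) :
    PowerSeries.constantCoeff (periodSeries ϖ) = 0 := by
  rw [← PowerSeries.coeff_zero_eq_constantCoeff_apply, periodSeries, PowerSeries.coeff_rescale]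
  simp [constantCoeff_carlitzSeries]

lemma norm_carlitzExp_mul_le {ϖ ε : CInf F} (h : ‖ϖ * ε‖ ≤ 1) :
    ‖carlitzExp (ϖ * ε)‖ ≤ ‖ϖ * ε‖ := by
  refine (sumsTo_periodSeries ϖ ε).norm_le_of_ultrametric (norm_nonneg _) fun m => ?_
  rcases m with _ | m
  · simpa [constantCoeff_periodSeries] using mul_nonneg (norm_nonneg ϖ) (norm_nonneg ε)
  · rw [norm_mul, norm_pow]
    calc _ ≤ ‖ϖ‖ ^ (m + 1) * ‖ε‖ ^ (m + 1) := by gcongr; exact norm_coeff_periodSeries_le ϖ _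
      _ = ‖ϖ * ε‖ ^ (m + 1) := by rw [norm_mul, mul_pow]
      _ ≤ ‖ϖ * ε‖ := pow_le_of_le_one (norm_nonneg _) h (by omega)

lemma carlitzExp_period_mul_ne_zero {ϖ : CInf F} (hϖ : IsFundamentalPeriod ϖ) (z : Omega F) :
    carlitzExp (ϖ * (z : CInf F)) ≠ 0 := by
  intro h
  have h1 : ϖ * (z : CInf F) ∈ {z : CInf F | carlitzExp z = 0} := h
  rw [hϖ.2] at h1
  obtain ⟨a, ha⟩ := h1
  have := mul_left_cancel₀ hϖ.1 ha
  exact z.2 ⟨_, this⟩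

/-- `t(z + ε) = t(z) / (1 + t(z) e_C(ϖ ε))`, by additivity of the Carlitz exponential. -/
lemma tParam_add {ϖ : CInf F} (hϖ : IsFundamentalPeriod ϖ) (z w : Omega F) {ε : CInf F}
    (hw : (w : CInf F) = z + ε) :
    tParam ϖ w = tParam ϖ z * (1 + tParam ϖ z * carlitzExp (ϖ * ε))⁻¹ := by
  have h := carlitzExp_period_mul_ne_zero hϖ z
  rw [tParam, tParam, hw, mul_add, carlitzExp_add]
  field_simp

/-! ### Hyperderivatives of functions holomorphic at infinity -/

/-- The power series with coefficients `cᵢ * binom(-i, k)`. -/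
def twistedSeries (c : ℕ → CInf F) (k : ℕ) : PowerSeries (CInf F) :=
  PowerSeries.mk fun i => c i * (Ring.choose (-(i : ℤ)) k : ℤ)

/-- If `f = ∑ cᵢ tⁱ`, then `𝒟ₙ f` is the value at `t` of this power series, in which only the
coefficients of `εⁿ` in the powers of `e_C(ϖ ε)` enter. -/
def hyperDerivSeries (ϖ : CInf F) (c : ℕ → CInf F) (n : ℕ) : PowerSeries (CInf F) :=
  ∑ k ∈ Finset.range (n + 1), PowerSeries.C (PowerSeries.coeff n (periodSeries ϖ ^ k)) *
    (twistedSeries c k * PowerSeries.X ^ k)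

/-- If `f = ∑ cᵢ tⁱ` for `|z|_i ≥ M`, then `f(z + ε) = ∑ cᵢ tⁱ (1 + t e_C(ϖ ε))⁻ⁱ` is expanded by
the binomial series in powers of `e_C(ϖ ε)`, and then in powers of `ε`; the coefficients are power
series in `t`. -/
lemma hasTaylorExpansionAt_of_tExpansion {ϖ : CInf F} (hϖ : IsFundamentalPeriod ϖ)
    {f : Omega F → CInf F} {c : ℕ → CInf F} {M : ℝ}
    (hc : ∀ z : Omega F, M ≤ imagPart (z : CInf F) →
      HasSum (fun i => c i * tParam ϖ z ^ i) (f z)) {z : Omega F} (hz : M ≤ imagPart (z : CInf F)) :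
    ∃ a : ℕ → CInf F, HasTaylorExpansionAt f z a ∧
      ∀ n, SumsTo (hyperDerivSeries ϖ c n) (tParam ϖ z) (a n) := by
  set t := tParam ϖ z with ht
  have hct : Summable fun i => c i * t ^ i := (hc z hz).summable
  have hchoose : ∀ (i k : ℕ), ‖((Ring.choose (-(i : ℤ)) k : ℤ) : CInf F)‖ ≤ 1 :=
    fun i k => norm_intCast_le_one _
  have htw : ∀ k, Summable fun i => PowerSeries.coeff i (twistedSeries c k) * t ^ i := fun k => by
    refine hct.of_norm_le_norm fun i => ?_
    rw [twistedSeries, PowerSeries.coeff_mk, norm_mul, norm_mul, norm_mul]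
    gcongr
    exact mul_le_of_le_one_right (norm_nonneg _) (hchoose i k)
  choose g hg using htw
  have hg' : ∀ k, SumsTo (twistedSeries c k) t (g k) := hg
  refine ⟨fun n => ∑ k ∈ Finset.range (n + 1),
    PowerSeries.coeff n (periodSeries ϖ ^ k) * (g k * t ^ k), ?_, fun n =>
    SumsTo.sum fun k _ => (SumsTo.const _ t).mul ((hg' k).mul ((SumsTo.X t).pow k))⟩
  obtain ⟨B, hB⟩ := hct.tendsto_atTop_zero.norm.bddAbove_range
  have hB' : ∀ i, ‖c i * t ^ i‖ ≤ B := fun i => hB ⟨i, rfl⟩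
  have hB0 : 0 ≤ B := (norm_nonneg _).trans (hB' 0)
  have hgB : ∀ k, ‖g k‖ ≤ B := fun k => (hg k).norm_le_of_ultrametric hB0 fun i => by
    refine le_trans ?_ (hB' i)
    rw [twistedSeries, PowerSeries.coeff_mk, norm_mul, norm_mul, norm_mul]
    gcongr
    exact mul_le_of_le_one_right (norm_nonneg _) (hchoose i k)
  -- the radius `1 / (4 s ‖ϖ‖)` makes the double series below converge geometrically: its term of
  -- index `(k, m)` vanishes for `m < k` and is otherwise at most `B 4⁻ᵐ ≤ B 2⁻ᵏ 2⁻ᵐ`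
  set s := max 1 ‖t‖ with hs
  have hs1 : 1 ≤ s := le_max_left _ _
  have hϖ0 : 0 < ‖ϖ‖ := norm_pos_iff.2 hϖ.1
  refine ⟨min (imagPart (z : CInf F)) (1 / (4 * s * ‖ϖ‖)),
    lt_min (imagPart_pos z) (by positivity), fun ε hε => ?_⟩
  have hε1 := hε.trans_le (min_le_left _ _)
  have hε2 := hε.trans_le (min_le_right _ _)
  have him := le_imagPart_add le_rfl hε1
  have hmem : (z : CInf F) + ε ∈ Omega F :=
    mem_omega_of_imagPart_pos ((imagPart_pos z).trans_le him)
  refine ⟨hmem, ?_⟩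
  set w : Omega F := ⟨z + ε, hmem⟩ with hw
  set u := carlitzExp (ϖ * ε) with hu
  have hsε : s * ‖ϖ * ε‖ ≤ 1 / 4 := by
    rw [lt_div_iff₀ (by positivity)] at hε2
    rw [norm_mul]
    linarith
  have hϖε : ‖ϖ * ε‖ ≤ 1 / 4 :=
    (le_mul_of_one_le_left (norm_nonneg _) hs1).trans hsε
  have hu1 : ‖u‖ ≤ ‖ϖ * ε‖ := norm_carlitzExp_mul_le (hϖε.trans (by norm_num))
  have htu : ‖t * u‖ < 1 := by
    rw [norm_mul]
    calc _ ≤ s * ‖ϖ * ε‖ := by gcongr; exact le_max_right _ _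
      _ < 1 := hsε.trans_lt (by norm_num)
  -- expand `f(z + ε) = ∑ cᵢ tⁱ (1 + t u)⁻ⁱ` in powers of `u`
  have hf1 := hc w (hz.trans him)
  have hrow : ∀ i, HasSum (fun k => c i * t ^ i * ((Ring.choose (-(i : ℤ)) k : ℤ) * (t * u) ^ k))
      (c i * tParam ϖ w ^ i) := fun i => by
    have h1 := sumsTo_binomialSeries (-(i : ℤ)) htu
    have h2 := HasSum.mul_left (c i * t ^ i) h1
    simp only [PowerSeries.binomialSeries_coeff, zsmul_eq_mul, mul_one] at h2
    rw [zpow_neg, zpow_natCast, ← inv_pow] at h2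
    rwa [tParam_add hϖ z w rfl, mul_pow, ← mul_assoc]
  have hcol : ∀ k, HasSum (fun i => c i * t ^ i * ((Ring.choose (-(i : ℤ)) k : ℤ) * (t * u) ^ k))
      (g k * t ^ k * u ^ k) := fun k => by
    have h1 := HasSum.mul_right ((t * u) ^ k) (hg k)
    refine h1.of_eq (fun i => ?_) (by ring)
    rw [twistedSeries, PowerSeries.coeff_mk]
    ring
  have hsum1 : Summable fun x : ℕ × ℕ =>
      c x.1 * t ^ x.1 * ((Ring.choose (-(x.1 : ℤ)) x.2 : ℤ) * (t * u) ^ x.2) := by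
    refine (hct.mul_of_nonarchimedean (summable_geometric_of_norm_lt_one htu)).of_norm_le_norm
      fun x => ?_
    simp only [norm_mul, norm_pow]
    exact mul_le_mul_of_nonneg_left (mul_le_of_le_one_left (by positivity) (hchoose _ _))
      (by positivity)
  have hf2 : HasSum (fun k => g k * t ^ k * u ^ k) (f w) :=
    HasSum.swap_of_summable hsum1 hrow hcol hf1
  -- expand the powers of `u` in powers of `ε`
  have hrow2 : ∀ k, HasSum (fun m => g k * t ^ k *
      (PowerSeries.coeff m (periodSeries ϖ ^ k) * ε ^ m)) (g k * t ^ k * u ^ k) := fun k =>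
    HasSum.mul_left _ ((sumsTo_periodSeries ϖ ε).pow k)
  have hcol2 : ∀ m, HasSum (fun k => g k * t ^ k *
      (PowerSeries.coeff m (periodSeries ϖ ^ k) * ε ^ m)) ((∑ k ∈ Finset.range (m + 1),
      PowerSeries.coeff m (periodSeries ϖ ^ k) * (g k * t ^ k)) * ε ^ m) := fun m => by
    refine (hasSum_sum_of_ne_finset_zero (s := Finset.range (m + 1)) fun k hk => ?_).of_eq
      (fun _ => rfl) ?_
    · rw [coeff_pow_eq_zero_of_lt (constantCoeff_periodSeries ϖ) (by simpa using hk)]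
      ring
    · rw [Finset.sum_mul]
      exact Finset.sum_congr rfl fun k _ => by ring
  have hsum2 : Summable fun x : ℕ × ℕ => g x.1 * t ^ x.1 *
      (PowerSeries.coeff x.2 (periodSeries ϖ ^ x.1) * ε ^ x.2) := by
    have hgeo : Summable fun x : ℕ × ℕ => B * ((1 / 2 : ℝ) ^ x.1 * (1 / 2 : ℝ) ^ x.2) :=
      (summable_geometric_two.mul_of_nonneg summable_geometric_two
        (fun _ => by positivity) fun _ => by positivity).mul_left B
    refine Summable.of_norm_bounded hgeo fun ⟨k, m⟩ => ?_
    dsimp only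
    by_cases hkm : m < k
    · rw [coeff_pow_eq_zero_of_lt (constantCoeff_periodSeries ϖ) hkm]
      simp only [zero_mul, mul_zero, norm_zero]
      positivity
    · rw [not_lt] at hkm
      have h1 : ‖t‖ ^ k ≤ s ^ m :=
        (pow_le_pow_left₀ (norm_nonneg _) (le_max_right _ _) k).trans (pow_le_pow_right₀ hs1 hkm)
      have h2 := norm_coeff_pow_le hϖ0.le (norm_coeff_periodSeries_le ϖ) k m
      rw [norm_mul, norm_mul, norm_mul, norm_pow, norm_pow, mul_assoc]
      refine mul_le_mul (hgB k) ?_ (by positivity) hB0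
      calc ‖t‖ ^ k * (‖PowerSeries.coeff m (periodSeries ϖ ^ k)‖ * ‖ε‖ ^ m)
          ≤ s ^ m * (‖ϖ‖ ^ m * ‖ε‖ ^ m) := by gcongr
        _ = (s * ‖ϖ * ε‖) ^ m := by rw [norm_mul]; ring
        _ ≤ (1 / 4) ^ m := by gcongr
        _ = (1 / 2) ^ m * (1 / 2) ^ m := by rw [← mul_pow]; norm_num
        _ ≤ (1 / 2) ^ k * (1 / 2) ^ m := by
          gcongr ?_ * _
          exact pow_le_pow_of_le_one (by norm_num) (by norm_num) hkm
  exact HasSum.swap_of_summable hsum2 hrow2 hcol2 hf2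

/-- Hyperderivatives preserve holomorphy at infinity. -/
lemma IsHolomorphicAtInfty.hyperDeriv {ϖ : CInf F} (hϖ : IsFundamentalPeriod ϖ)
    {f : Omega F → CInf F} (hf : IsHolomorphicAtInfty ϖ f) (n : ℕ) :
    IsHolomorphicAtInfty ϖ (hyperDeriv n f) := by
  obtain ⟨c, M, hc⟩ := hf
  refine ⟨fun i => PowerSeries.coeff i (hyperDerivSeries ϖ c n), M, fun z hz => ?_⟩
  obtain ⟨a, ha, h⟩ := hasTaylorExpansionAt_of_tExpansion hϖ hc hz
  rw [ha.hyperDeriv_eq]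
  exact h n

lemma hyperDeriv_translate {f : Omega F → CInf F} (hf : IsHolomorphic f)
    (hper : ∀ (a : F[X]) (z : Omega F), f (translate a z) = f z) (n : ℕ) (a : F[X])
    (z : Omega F) : hyperDeriv n f (translate a z) = hyperDeriv n f z := by
  obtain ⟨ρ, hρ, h⟩ := hf.hasTaylorExpansionAt z
  refine HasTaylorExpansionAt.hyperDeriv_eq (a := fun n => Drinfeld.hyperDeriv n f z)
    ⟨ρ, hρ, fun ε hε => ?_⟩ n
  obtain ⟨hm, hs⟩ := h ε hε
  have he : ((translate a z : Omega F) : CInf F) + ε =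
      (translate a ⟨z + ε, hm⟩ : Omega F) := by
    simp only [translate]
    ring
  have hm' : ((translate a z : Omega F) : CInf F) + ε ∈ Omega F := he ▸ (translate a _).2
  refine ⟨hm', ?_⟩
  rw [show (⟨_, hm'⟩ : Omega F) = translate a ⟨z + ε, hm⟩ from Subtype.ext he, hper]
  exact hs

lemma hyperDeriv_mem_ringO {ϖ : CInf F} (hϖ : IsFundamentalPeriod ϖ) {f : Omega F → CInf F}
    (hf : f ∈ ringO ϖ) (n : ℕ) : hyperDeriv n f ∈ ringO ϖ :=
  ⟨hf.1.hyperDeriv n, hyperDeriv_translate hf.1 hf.2.1 n, hf.2.2.hyperDeriv hϖ n⟩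

/-- The additive group underlying the ring `𝒪`. -/
def ringOAddSubgroup (ϖ : CInf F) : AddSubgroup (Omega F → CInf F) where
  carrier := ringO ϖ
  zero_mem' := ⟨isHolomorphic_zero, by simp, 0, 0, by simp⟩
  add_mem' := by
    rintro f g ⟨hf, hfp, c, M, hc⟩ ⟨hg, hgp, d, N, hd⟩
    refine ⟨hf.add hg, fun a z => by simp [hfp, hgp], c + d, max M N, fun z hz => ?_⟩
    simpa [add_mul] using
      (hc z ((le_max_left _ _).trans hz)).add (hd z ((le_max_right _ _).trans hz))
  neg_mem' := by
    rintro f ⟨hf, hfp, c, M, hc⟩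
    exact ⟨hf.neg, fun a z => by simp [hfp], -c, M, fun z hz => by simpa using (hc z hz).neg⟩

/-! ### Möbius substitutions in power series -/

section MoebiusSubstitution

lemma choose_neg_mul_neg_pow {K : Type*} [Field K] (N : ℤ) (r : ℕ) (x : K) :
    ((Ring.choose (-N) r : ℤ) : K) * (-x) ^ r = (Ring.choose (N + r - 1) r : ℤ) * x ^ r := by
  rw [Ring.choose_neg, neg_pow x, Units.smul_def, smul_eq_mul, Int.cast_mul,
    Int.cast_negOnePow_natCast, mul_right_comm, ← mul_assoc, ← mul_pow]
  simp [mul_comm]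

variable {K : Type*} [NontriviallyNormedField K]

/-- The power series of `η ↦ (1 - x η) ^ (-N) p(b η / (1 - x η))`. -/
def moebiusSubst (N : ℤ) (b x : K) (p : PowerSeries K) : PowerSeries K :=
  PowerSeries.mk fun n => ∑ y ∈ Finset.HasAntidiagonal.antidiagonal n,
    PowerSeries.coeff y.1 p * b ^ y.1 * ((Ring.choose (N + n - 1) y.2 : ℤ) * x ^ y.2)

lemma SumsTo.moebiusSubst [IsUltrametricDist K] [CompleteSpace K] {N : ℤ}
    {b x η v w : K} {p : PowerSeries K} (hb : SumsTo p (b * η) w)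
    (hx : ‖x * η‖ < 1) (hv : SumsTo p (b * η * (1 - x * η)⁻¹) v) :
    SumsTo (moebiusSubst N b x p) η ((1 - x * η) ^ (-N) * v) := by
  set y := 1 - x * η with hy
  have hy0 : y ≠ 0 := by
    intro h
    rw [← sub_eq_zero.1 h, norm_one] at hx
    exact hx.false
  have hrow : ∀ s : ℕ, HasSum (fun r : ℕ => PowerSeries.coeff s p * (b * η) ^ s *
      ((Ring.choose (N + s + r - 1) r : ℤ) * (x * η) ^ r))
      (y ^ (-N) * (PowerSeries.coeff s p * (b * η * y⁻¹) ^ s)) := fun s => by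
    have h1 := sumsTo_binomialSeries (K := K) (y := -(x * η)) (-(N + s)) (by rwa [norm_neg])
    have h2 := HasSum.mul_left (PowerSeries.coeff s p * (b * η) ^ s) h1
    refine h2.of_eq (fun r => ?_) ?_
    · rw [PowerSeries.binomialSeries_coeff, zsmul_eq_mul, mul_one, choose_neg_mul_neg_pow]
    · rw [← sub_eq_add_neg, ← hy, neg_add, zpow_add₀ hy0, zpow_neg y s, zpow_natCast, mul_pow,
        inv_pow]
      ring
  have hsum : Summable fun z : ℕ × ℕ => PowerSeries.coeff z.1 p * (b * η) ^ z.1 *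
      ((Ring.choose (N + z.1 + z.2 - 1) z.2 : ℤ) * (x * η) ^ z.2) := by
    refine (Summable.mul_of_nonarchimedean (HasSum.summable hb)
      (summable_geometric_of_norm_lt_one hx)).of_norm_le_norm fun z => ?_
    rw [norm_mul, norm_mul _ ((x * η) ^ z.2), norm_mul _ ((x * η) ^ z.2)]
    exact mul_le_mul_of_nonneg_left (mul_le_of_le_one_left (norm_nonneg _)
      (norm_intCast_le_one _)) (norm_nonneg _)
  have h1 := hsum.hasSum.prod_fiberwise hrow
  have h2 := h1.unique (HasSum.mul_left (y ^ (-N)) hv)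
  refine hsum.hasSum.antidiagonal.of_eq (fun n => ?_) h2.symm
  rw [Drinfeld.moebiusSubst, PowerSeries.coeff_mk, Finset.sum_mul]
  refine Finset.sum_congr rfl fun z hz => ?_
  rw [← Finset.HasAntidiagonal.mem_antidiagonal.1 hz]
  push_cast
  rw [← add_assoc, pow_add, mul_pow, mul_pow]
  ring

end MoebiusSubstitution

/-! ### The expansion of a quasi-modular form at `γ(z)` -/

/-- The polynomial over `C` obtained by evaluating at `z` the coefficients of `P ∈ 𝒪[X]`. -/
def specialize (P : (Omega F → CInf F)[X]) (z : Omega F) : (CInf F)[X] :=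
  P.map (Pi.evalRingHom (fun _ => CInf F) z)

lemma coeff_specialize (P : (Omega F → CInf F)[X]) (z : Omega F) (i : ℕ) :
    (specialize P z).coeff i = P.coeff i z := by
  simp [specialize]

lemma eval_specialize {P : (Omega F → CInf F)[X]} {k : ℕ} (hk : P.natDegree < k) (z : Omega F)
    (x : CInf F) : (specialize P z).eval x = ∑ i ∈ Finset.range k, P.coeff i z * x ^ i := by
  have hd : (specialize P z).natDegree < k := natDegree_map_le.trans_lt hk
  simp only [eval_eq_sum_range' hd, coeff_specialize]

lemma IsAssociated.apply_moebius {ϖ : CInf F} {w : ℕ} {m : ZMod (Fintype.card F - 1)}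
    {f : Omega F → CInf F} {P : (Omega F → CInf F)[X]} (h : IsAssociated ϖ w m f P)
    (γ : GL (Fin 2) F[X]) (z : Omega F) :
    f (moebius γ z) = den γ z ^ w * detC γ ^ (-(m.val : ℤ)) *
      (specialize P z).eval (ofA F (γ 1 0) / den γ z) := by
  rw [h.2, eval_specialize (Nat.lt_succ_self _)]

/-- With `y = 1 - c D η / δ`, where `D = cz + d` and `δ = det γ`, the substitution
`ε = D² η / (δ y)` satisfies `c (z + ε) + d = D / y`. -/
lemma den_add (γ : GL (Fin 2) F[X]) (z η : CInf F)
    (hy : 1 - ofA F (γ 1 0) * den γ z / detC γ * η ≠ 0) :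
    den γ (z + den γ z ^ 2 / detC γ * η * (1 - ofA F (γ 1 0) * den γ z / detC γ * η)⁻¹) =
      den γ z * (1 - ofA F (γ 1 0) * den γ z / detC γ * η)⁻¹ := by
  have hδ := detC_ne_zero γ
  set D := den γ z with hD
  set y := 1 - ofA F (γ 1 0) * D / detC γ * η with hydef
  have h1 : den γ (z + D ^ 2 / detC γ * η * y⁻¹) =
      D + ofA F (γ 1 0) * (D ^ 2 / detC γ * η * y⁻¹) := by
    rw [hD]; unfold den; ring
  rw [h1]
  have h2 : y * detC γ = detC γ - ofA F (γ 1 0) * D * η := by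
    rw [hydef]; field_simp
  clear_value y
  field_simp
  linear_combination D * h2

/-- With the same substitution, `γ(z + ε) = γ(z) + η`. -/
lemma moebius_add (γ : GL (Fin 2) F[X]) (z z' : Omega F) (η : CInf F)
    (hy : 1 - ofA F (γ 1 0) * den γ z / detC γ * η ≠ 0)
    (hz' : (z' : CInf F) = z + den γ z ^ 2 / detC γ * η *
      (1 - ofA F (γ 1 0) * den γ z / detC γ * η)⁻¹) :
    (moebius γ z' : CInf F) = moebius γ z + η := by
  have hδ := detC_ne_zero γ
  have hD0 := den_ne_zero γ z
  have hden := den_add γ z η hy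
  rw [← hz'] at hden
  change (ofA F (γ 0 0) * (z' : CInf F) + ofA F (γ 0 1)) / den γ z' =
    (ofA F (γ 0 0) * (z : CInf F) + ofA F (γ 0 1)) / den γ z + η
  rw [hden, hz']
  have hDdef : den γ z = ofA F (γ 1 0) * z + ofA F (γ 1 1) := rfl
  have hdet := detC_eq γ
  set D := den γ z with hD
  set y := 1 - ofA F (γ 1 0) * D / detC γ * η with hydef
  have h2 : y * detC γ = detC γ - ofA F (γ 1 0) * D * η := by
    rw [hydef]; field_simp
  clear_value y D
  generalize ofA F (γ 0 0) = a at *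
  generalize ofA F (γ 0 1) = b at *
  generalize ofA F (γ 1 0) = c at *
  generalize ofA F (γ 1 1) = d at *
  generalize detC γ = δ at *
  field_simp
  linear_combination (a * (z : CInf F) + b) * h2 + D * η * a * hDdef - D * η * hdet

/-- The expansion of `f` at `γ(z)`, obtained from the expansions at `z` of the coefficients `fᵢ` of
`P` by substituting `ε = D² η / (δ - c D η)` in the functional equation for `f(γ(z + ε))`. -/
lemma IsAssociated.hyperDeriv_moebius {ϖ : CInf F} {w : ℕ} {m : ZMod (Fintype.card F - 1)}
    {f : Omega F → CInf F} {P : (Omega F → CInf F)[X]} (h : IsAssociated ϖ w m f P)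
    {l : ℕ} (hl : P.natDegree ≤ l) (γ : GL (Fin 2) F[X]) (z : Omega F) (n : ℕ) :
    hyperDeriv n f (moebius γ z) = den γ z ^ w * detC γ ^ (-(m.val : ℤ)) *
      ∑ i ∈ Finset.range (l + 1), (ofA F (γ 1 0) / den γ z) ^ i *
        PowerSeries.coeff n (moebiusSubst ((w : ℤ) - i) (den γ z ^ 2 / detC γ)
          (ofA F (γ 1 0) * den γ z / detC γ)
          (PowerSeries.mk fun s => hyperDeriv s (P.coeff i) z)) := by
  have hδ := detC_ne_zero γ
  have hD0 := den_ne_zero γ z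
  set D := den γ z with hD
  set b := D ^ 2 / detC γ with hb
  set x := ofA F (γ 1 0) * D / detC γ with hx
  set C₀ := D ^ w * detC γ ^ (-(m.val : ℤ)) with hC₀
  have hb0 : b ≠ 0 := by positivity
  obtain ⟨N, hN⟩ := exists_mem_affinoid z
  have hR := norm_pos_iff.2 (discRadius_ne_zero (F := F) N)
  -- the radius ensures `|b η| ≤ q ^ (-(N + 1))` and `|x η| < 1`, hence `|1 - x η| = 1` and
  -- `|ε| = |b η|` for `ε = b η / (1 - x η)`
  have hkey := hasTaylorExpansionAt_of_sumsTo (f := f) (z := moebius γ z)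
    (ρ := min (‖discRadius F N‖ / ‖b‖) (1 / (‖x‖ + 1)))
    (p := PowerSeries.C C₀ * ∑ i ∈ Finset.range (l + 1),
      PowerSeries.C ((ofA F (γ 1 0) / D) ^ i) * moebiusSubst ((w : ℤ) - i) b x
        (PowerSeries.mk fun s => hyperDeriv s (P.coeff i) z))
    (lt_min (div_pos hR (norm_pos_iff.2 hb0)) (by positivity)) ?_
  · rw [hkey.hyperDeriv_eq]
    simp only [PowerSeries.coeff_C_mul, map_sum]
  intro η hη
  have hη1 : ‖b * η‖ ≤ ‖discRadius F N‖ := by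
    have := hη.le.trans (min_le_left _ _)
    rwa [le_div_iff₀ (norm_pos_iff.2 hb0), mul_comm, ← norm_mul] at this
  have hη2 : ‖x * η‖ < 1 := by
    have := hη.trans_le (min_le_right _ _)
    rw [lt_div_iff₀ (by positivity)] at this
    rw [norm_mul]
    nlinarith [norm_nonneg η, norm_nonneg x]
  set y := 1 - x * η with hy
  have hy1 : ‖y‖ = 1 := by
    rw [hy, sub_eq_add_neg, IsUltrametricDist.norm_add_eq_max_of_norm_ne_norm
      (by rw [norm_one, norm_neg]; exact hη2.ne'), norm_one, norm_neg, max_eq_left hη2.le]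
  have hy0 : y ≠ 0 := norm_pos_iff.1 (by rw [hy1]; exact one_pos)
  have hε : ‖b * η * y⁻¹‖ ≤ ‖discRadius F N‖ := by
    rwa [norm_mul, norm_inv, hy1, inv_one, mul_one]
  have hmem := affinoid_subset_omega N (add_mem_affinoid hN hε)
  set z' : Omega F := ⟨z + b * η * y⁻¹, hmem⟩ with hz'
  have hmoeb : extendZero f (moebius γ z + η) = f (moebius γ z') := by
    rw [← moebius_add γ z z' η hy0 rfl, extendZero_coe]
  have hden : den γ z' = D * y⁻¹ := den_add γ z η hy0
  have hval : f (moebius γ z') = C₀ * ∑ i ∈ Finset.range (l + 1), (ofA F (γ 1 0) / D) ^ i *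
      (y ^ (-((w : ℤ) - i)) * P.coeff i z') := by
    rw [h.apply_moebius, eval_specialize (Nat.lt_succ_of_le hl), hden, hC₀, Finset.mul_sum,
      Finset.mul_sum]
    refine Finset.sum_congr rfl fun i _ => ?_
    rw [neg_sub, zpow_sub₀ hy0, zpow_natCast, zpow_natCast, mul_pow, div_pow, div_pow, mul_pow,
      inv_pow, inv_pow]
    field_simp
  rw [hmoeb, hval]
  refine (SumsTo.const _ _).mul (SumsTo.sum fun i _ => (SumsTo.const _ _).mul ?_)
  have hi := (h.1 i).1
  refine SumsTo.moebiusSubst (hi.sumsTo_hyperDeriv hN hη1) hη2 ?_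
  have := hi.sumsTo_hyperDeriv hN hε
  rwa [extendZero_of_mem _ hmem] at this

lemma detC_pow_card_sub_one (γ : GL (Fin 2) F[X]) : detC γ ^ (Fintype.card F - 1) = 1 := by
  obtain ⟨u, hu, hu'⟩ := Polynomial.isUnit_iff.1 ((Matrix.isUnit_iff_isUnit_det _).1 γ.isUnit)
  rw [detC, ← hu', ← map_pow, ← C_pow, FiniteField.pow_card_sub_one_eq_one u hu.ne_zero, C_1,
    map_one]

lemma detC_pow_val_add (γ : GL (Fin 2) F[X]) (m : ZMod (Fintype.card F - 1)) (n : ℕ) :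
    detC γ ^ (-((m + n).val : ℤ)) = detC γ ^ (-(m.val : ℤ)) * (detC γ ^ n)⁻¹ := by
  have : NeZero (Fintype.card F - 1) := ⟨by have := Fintype.one_lt_card (α := F); omega⟩
  rw [zpow_neg, zpow_neg, zpow_natCast, zpow_natCast, ← mul_inv, ← pow_add, ZMod.val_add,
    ZMod.val_natCast, Nat.add_mod_mod, ← pow_eq_pow_mod _ (detC_pow_card_sub_one γ)]

/-! ### Uniqueness of the associated polynomial -/

section Uniqueness

/-- The matrix `(1 a; c 1 + ca)` of determinant one. -/
def bottomRow (c a : F[X]) : GL (Fin 2) F[X] :=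
  Matrix.GeneralLinearGroup.mk'' !![1, a; c, 1 + c * a] (by simp [Matrix.det_fin_two, mul_comm])

lemma bottomRow_apply {F : Type*} [Field F] (c a : F[X]) (i j : Fin 2) :
    bottomRow c a i j = !![1, a; c, 1 + c * a] i j := rfl

lemma detC_bottomRow (c a : F[X]) : detC (bottomRow c a) = 1 := by
  rw [detC_eq]
  simp [bottomRow_apply]
  ring

lemma den_bottomRow (c a : F[X]) (z : CInf F) :
    den (bottomRow c a) z = ofA F c * z + 1 + ofA F c * ofA F a := by
  simp [den, bottomRow_apply, add_assoc]

/-- `d ^ w p(c / d) = d ^ w' p'(c / d)` is, up to a power of `d`, a polynomial identity in `d`, so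
it holds for all `d ≠ 0` as soon as it holds for infinitely many. -/
lemma pow_mul_eval_div_eq_of_infinite {K : Type*} [Field K] {p p' : K[X]} {w w' : ℕ} {c : K}
    {S : Set K} (hS : S.Infinite) (hS0 : ∀ d ∈ S, d ≠ 0)
    (h : ∀ d ∈ S, d ^ w * p.eval (c / d) = d ^ w' * p'.eval (c / d)) (d : K) (hd : d ≠ 0) :
    d ^ w * p.eval (c / d) = d ^ w' * p'.eval (c / d) := by
  set k := max p.natDegree p'.natDegree with hk
  have hom : ∀ (r : K[X]), r.natDegree ≤ k → ∃ R : K[X], ∀ d : K, d ≠ 0 →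
      R.eval d = d ^ k * r.eval (c / d) := fun r hr => by
    refine ⟨∑ i ∈ Finset.range (k + 1), C (r.coeff i * c ^ i) * X ^ (k - i), fun d hd => ?_⟩
    rw [eval_eq_sum_range' (Nat.lt_succ_of_le hr), eval_finsetSum, Finset.mul_sum]
    refine Finset.sum_congr rfl fun i hi => ?_
    have hik : i ≤ k := Nat.lt_succ_iff.1 (Finset.mem_range.1 hi)
    rw [eval_mul, eval_C, eval_pow, eval_X, div_pow, pow_sub₀ _ hd hik]
    field_simp
  obtain ⟨R, hR⟩ := hom p (le_max_left _ _)
  obtain ⟨R', hR'⟩ := hom p' (le_max_right _ _)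
  have heq : X ^ w * R = X ^ w' * R' := by
    refine eq_of_infinite_eval_eq _ _ (hS.mono fun d hd => ?_)
    simp only [Set.mem_ofPred_eq, eval_mul, eval_pow, eval_X, hR d (hS0 d hd), hR' d (hS0 d hd)]
    rw [mul_left_comm, h d hd, mul_left_comm]
  have := congrArg (eval d) heq
  simp only [eval_mul, eval_pow, eval_X, hR d hd, hR' d hd] at this
  rw [mul_left_comm, mul_left_comm (d ^ w')] at this
  exact mul_left_cancel₀ (pow_ne_zero k hd) this

/-- The associated polynomial does not depend on the choice of weight and type. The bottom rows
`(1, 1 + a)` determine `P` up to a shift by the difference of the weights, and comparison with the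
bottom rows `(T, 1 + Ta)` shows that `P = P' = 0` if the weights differ. -/
lemma IsAssociated.unique {ϖ : CInf F} {w w' : ℕ} {m m' : ZMod (Fintype.card F - 1)}
    {f : Omega F → CInf F} {P P' : (Omega F → CInf F)[X]} (h : IsAssociated ϖ w m f P)
    (h' : IsAssociated ϖ w' m' f P') : P = P' := by
  suffices hs : ∀ z : Omega F, specialize P z = specialize P' z by
    ext i z
    rw [← coeff_specialize, hs z, coeff_specialize]
  intro z
  set p := specialize P z with hp
  set p' := specialize P' z with hp'
  have hrow : ∀ c : F[X], c ≠ 0 → ∀ d : CInf F, d ≠ 0 →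
      d ^ w * p.eval (ofA F c / d) = d ^ w' * p'.eval (ofA F c / d) := fun c hc => by
    have hc' : ofA F c ≠ 0 := by simpa using ofA_injective.ne hc
    refine pow_mul_eval_div_eq_of_infinite
      (S := Set.range fun a : F[X] => den (bottomRow c a) (z : CInf F))
      (Set.infinite_range_of_injective fun a a' haa => ?_) ?_ ?_
    · simp only [den_bottomRow] at haa
      exact ofA_injective (mul_left_cancel₀ hc' (add_left_cancel haa))
    · rintro _ ⟨a, rfl⟩
      exact den_ne_zero _ z
    · rintro _ ⟨a, rfl⟩
      have h1 := h.apply_moebius (bottomRow c a) z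
      rw [h'.apply_moebius, detC_bottomRow, one_zpow, one_zpow, mul_one, mul_one] at h1
      exact h1.symm
  have h1 : ∀ d : CInf F, d ≠ 0 → d ^ w * p.eval d⁻¹ = d ^ w' * p'.eval d⁻¹ := fun d hd => by
    simpa using hrow 1 one_ne_zero d hd
  have hinf : Set.Infinite {d : CInf F | d ≠ 0} := (Set.finite_singleton 0).infinite_compl
  have hT : ofA F X ≠ 0 := by simpa using ofA_injective.ne (X_ne_zero (R := F))
  by_cases hw : w = w'
  · subst hw
    refine eq_of_infinite_eval_eq _ _ (hinf.mono fun d hd => ?_)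
    have := h1 d⁻¹ (inv_ne_zero hd)
    rw [inv_inv] at this
    exact mul_left_cancel₀ (pow_ne_zero w (inv_ne_zero hd)) this
  · have hTw : ofA F X ^ w ≠ ofA F X ^ w' := fun he => by
      rw [← map_pow, ← map_pow] at he
      have := congrArg natDegree (ofA_injective he)
      rw [natDegree_X_pow, natDegree_X_pow] at this
      exact hw this
    have hzero : ∀ d : CInf F, d ≠ 0 → d ^ w * p.eval d⁻¹ = 0 := fun d hd => by
      have h2 := hrow X X_ne_zero (ofA F X * d) (mul_ne_zero hT hd)
      rw [div_mul_cancel_left₀ hT, mul_pow, mul_pow, mul_assoc, mul_assoc, ← h1 d hd,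
        ← sub_eq_zero, ← sub_mul] at h2
      exact (mul_eq_zero.1 h2).resolve_left (sub_ne_zero.2 hTw)
    have hz : ∀ r : (CInf F)[X], ∀ k : ℕ, (∀ d : CInf F, d ≠ 0 → d ^ k * r.eval d⁻¹ = 0) →
        r = 0 := fun r k hr => by
      refine eq_of_infinite_eval_eq _ _ (hinf.mono fun d hd => ?_)
      have := (mul_eq_zero.1 (hr d⁻¹ (inv_ne_zero hd))).resolve_left
        (pow_ne_zero _ (inv_ne_zero hd))
      simpa using this
    rw [hz p w hzero, hz p' w' fun d hd => by rw [← h1 d hd, hzero d hd]]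

lemma IsAssociated.assocPoly_eq {ϖ : CInf F} {w : ℕ} {m : ZMod (Fintype.card F - 1)}
    {f : Omega F → CInf F} {P : (Omega F → CInf F)[X]} (h : IsAssociated ϖ w m f P) :
    assocPoly ϖ f = P := by
  have he : ∃ P, ∃ w m, IsAssociated ϖ w m f P := ⟨P, w, m, h⟩
  rw [assocPoly, dif_pos he]
  obtain ⟨w', m', h'⟩ := he.choose_spec
  exact h'.unique h

end Uniqueness

/-! ### The polynomial associated to a hyperderivative -/

/-- The polynomial associated to the `n`-th hyperderivative of a quasi-modular form of weight `w`
and depth at most `l` with associated polynomial `P`. -/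
def hyperDerivPoly (w l n : ℕ) (P : (Omega F → CInf F)[X]) : (Omega F → CInf F)[X] :=
  ∑ j ∈ Finset.range (n + l + 1), monomial j
    (∑ r ∈ Finset.range (n + 1), Ring.choose ((n : ℤ) + w + r - j - 1) r •
      hyperDeriv (n - r) (coeffInt P ((j : ℤ) - r)))

lemma coeff_hyperDerivPoly (w l n : ℕ) (P : (Omega F → CInf F)[X]) (j : ℕ) :
    (hyperDerivPoly w l n P).coeff j = if j < n + l + 1 then
      (∑ r ∈ Finset.range (n + 1), Ring.choose ((n : ℤ) + w + r - j - 1) r •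
        hyperDeriv (n - r) (coeffInt P ((j : ℤ) - r))) else 0 := by
  simp only [hyperDerivPoly, finsetSum_coeff, coeff_monomial]
  rw [Finset.sum_ite_eq']
  simp

lemma natDegree_hyperDerivPoly_le (w l n : ℕ) (P : (Omega F → CInf F)[X]) :
    (hyperDerivPoly w l n P).natDegree ≤ l + n := by
  refine natDegree_le_iff_coeff_eq_zero.2 fun j hj => ?_
  rw [coeff_hyperDerivPoly, if_neg (by omega)]

lemma coeffInt_mem_ringO {ϖ : CInf F} {P : (Omega F → CInf F)[X]}
    (hP : ∀ i, P.coeff i ∈ ringO ϖ) (i : ℤ) : coeffInt P i ∈ ringO ϖ := by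
  rw [coeffInt]
  split_ifs
  · exact hP _
  · exact (ringOAddSubgroup ϖ).zero_mem

lemma coeff_hyperDerivPoly_mem_ringO {ϖ : CInf F} (hϖ : IsFundamentalPeriod ϖ) (w l n : ℕ)
    {P : (Omega F → CInf F)[X]} (hP : ∀ i, P.coeff i ∈ ringO ϖ) (j : ℕ) :
    (hyperDerivPoly w l n P).coeff j ∈ ringO ϖ := by
  rw [coeff_hyperDerivPoly]
  split_ifs
  · exact (ringOAddSubgroup ϖ).sum_mem fun r _ => (ringOAddSubgroup ϖ).zsmul_mem
      (hyperDeriv_mem_ringO hϖ (coeffInt_mem_ringO hP _) _) _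
  · exact (ringOAddSubgroup ϖ).zero_mem

/-- The terms of `hyperDerivPoly`, grouped by the coefficients of `P`. -/
lemma eval_specialize_hyperDerivPoly (w l n : ℕ) {P : (Omega F → CInf F)[X]}
    (hl : P.natDegree ≤ l) (z : Omega F) (x : CInf F) :
    (specialize (hyperDerivPoly w l n P) z).eval x = ∑ i ∈ Finset.range (l + 1),
      ∑ r ∈ Finset.range (n + 1), (Ring.choose ((w : ℤ) - i + n - 1) r : ℤ) *
        hyperDeriv (n - r) (P.coeff i) z * x ^ (i + r) := by
  rw [eval_specialize (k := n + l + 1)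
    (by have := natDegree_hyperDerivPoly_le w l n P; omega)]
  have h1 : ∀ j ∈ Finset.range (n + l + 1), (hyperDerivPoly w l n P).coeff j z * x ^ j =
      ∑ r ∈ Finset.range (n + 1), (Ring.choose ((n : ℤ) + w + r - j - 1) r : ℤ) *
        hyperDeriv (n - r) (coeffInt P ((j : ℤ) - r)) z * x ^ j := fun j hj => by
    rw [coeff_hyperDerivPoly, if_pos (Finset.mem_range.1 hj), Finset.sum_apply, Finset.sum_mul]
    simp
  rw [Finset.sum_congr rfl h1, Finset.sum_comm, Finset.sum_comm (s := Finset.range (l + 1))]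
  refine Finset.sum_congr rfl fun r hr => Eq.symm ?_
  have hr' := Finset.mem_range.1 hr
  refine Finset.sum_of_injOn (fun i => i + r) (fun _ _ _ _ => by simp) (fun i hi => ?_)
    (fun j _ hj => ?_) (fun i _ => ?_)
  · have := Finset.mem_range.1 (Finset.mem_coe.1 hi)
    simp only [Finset.coe_range, Set.mem_Iio]
    omega
  · have h0 : coeffInt P ((j : ℤ) - r) = 0 := by
      rw [coeffInt]
      split_ifs with h
      · refine coeff_eq_zero_of_natDegree_lt ?_
        by_contra! hle
        exact hj ⟨j - r, by simp; omega, by simp; omega⟩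
      · rfl
    rw [h0, hyperDeriv_zero_fun]
    simp
  · rw [coeffInt, if_pos (by push_cast; omega)]
    congr 3
    · congr 2
      push_cast
      ring
    · congr 1
      push_cast
      simp

lemma IsAssociated.hyperDeriv {ϖ : CInf F} (hϖ : IsFundamentalPeriod ϖ) {w : ℕ}
    {m : ZMod (Fintype.card F - 1)} {f : Omega F → CInf F} {P : (Omega F → CInf F)[X]}
    (h : IsAssociated ϖ w m f P) {l : ℕ} (hl : P.natDegree ≤ l) (n : ℕ) :
    IsAssociated ϖ (w + 2 * n) (m + n) (hyperDeriv n f) (hyperDerivPoly w l n P) := by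
  refine ⟨coeff_hyperDerivPoly_mem_ringO hϖ w l n h.1, fun γ z => ?_⟩
  have hδ := detC_ne_zero γ
  have hD0 := den_ne_zero γ z
  rw [← eval_specialize (Nat.lt_succ_self _), h.hyperDeriv_moebius hl,
    eval_specialize_hyperDerivPoly w l n hl, detC_pow_val_add, Finset.mul_sum, Finset.mul_sum]
  refine Finset.sum_congr rfl fun i _ => ?_
  rw [moebiusSubst, PowerSeries.coeff_mk, Finset.mul_sum, Finset.mul_sum, Finset.mul_sum]
  refine Finset.sum_nbij' (fun y => y.2) (fun r => (n - r, r)) (fun y hy => ?_) (fun r hr => ?_)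
    (fun y hy => ?_) (fun _ _ => rfl) (fun y hy => ?_)
  · have := Finset.HasAntidiagonal.mem_antidiagonal.1 hy
    exact Finset.mem_range.2 (by omega)
  · have := Finset.mem_range.1 hr
    exact Finset.HasAntidiagonal.mem_antidiagonal.2 (by simp only; omega)
  · have := Finset.HasAntidiagonal.mem_antidiagonal.1 hy
    exact Prod.ext (by simp only; omega) rfl
  · obtain ⟨s, r⟩ := y
    obtain rfl : s + r = n := Finset.HasAntidiagonal.mem_antidiagonal.1 hy
    simp only [PowerSeries.coeff_mk, Nat.add_sub_cancel]
    generalize (Ring.choose ((w : ℤ) - i + (s + r : ℕ) - 1) r : ℤ) = k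
    simp only [div_pow, mul_pow, pow_add, mul_add]
    field_simp
    ring

end Drinfeld

end

theorem mainTheorem6 (F : Type*) [Field F] [Fintype F] (ϖ : Drinfeld.CInf F)
    (hϖ : Drinfeld.IsFundamentalPeriod ϖ) (w l : ℕ) (m : ZMod (Fintype.card F - 1))
    (f : Drinfeld.Omega F → Drinfeld.CInf F) (hf : f ∈ Drinfeld.quasiModular ϖ w m l) (n : ℕ) :
    Drinfeld.hyperDeriv n f ∈ Drinfeld.quasiModular ϖ (w + 2 * n) (m + n) (l + n) ∧
    Drinfeld.assocPoly ϖ (Drinfeld.hyperDeriv n f) =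
      ∑ j ∈ Finset.range (n + l + 1), Polynomial.monomial j
        (∑ r ∈ Finset.range (n + 1), Ring.choose ((n : ℤ) + w + r - j - 1) r •
          Drinfeld.hyperDeriv (n - r)
            (Drinfeld.coeffInt (Drinfeld.assocPoly ϖ f) ((j : ℤ) - r))) := by
  obtain ⟨hfh, P, hP, hl⟩ := hf
  have h := hP.hyperDeriv hϖ hl n
  refine ⟨⟨hfh.hyperDeriv n, _, h, Drinfeld.natDegree_hyperDerivPoly_le w l n P⟩, ?_⟩
  rw [h.assocPoly_eq, hP.assocPoly_eq, Drinfeld.hyperDerivPoly]
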